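/- Let $N\ge 0$ be an integer, let $\mathbb{D}^2$ be the open unit bidisk and $\mathbb{T}^2=(\partial\mathbb{D})^2$, with normalized Lebesgue measure. Let $\phi$ be an $N\times N$ matrix-valued rational inner function on $\mathbb{D}^2$; that is, $\phi$ is holomorphic on $\mathbb{D}^2$ with values in the closed unit ball for the operator norm, its radial boundary values $\phi(z)=\lim_{r\nearrow 1}\phi(rz)$ exist and are unitary matrices for almost every $z\in\mathbb{T}^2$, and $\phi=Q/p$ on $\mathbb{D}^2$, where $Q$ is an $N\times N$ matrix of polynomials in $\mathbb{C}[z_1,z_2]$ and $p\in\mathbb{C}[z_1,z_2]$ has no zeros in $\mathbb{D}^2$. Let $L^2=L^2(\mathbb{T}^2)\otimes\mathbb{C}^N$, let $Z_j$ denote multiplication by the coordinate $z_j$, and set \[ H^2=\{f\in L^2:\hat f(n_1,n_2)=0\text{ unless } n_1\ge 0 \text{ and } n_2\ge 0\},\qquad L^2_{--}=\{f\in L^2:\hat f(n_1,n_2)=0\text{ unless } n_1<0 \text{ and } n_2<0\}, \] \[ \mathcal{K}_\phi=H^2\cap\phi L^2_{--},\qquad \mathcal{K}^1_\phi=H^2\cap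 Z_1\phi L^2_{--},\qquad \mathcal{K}^2_\phi=H^2\cap Z_2\phi L^2_{--}. \] For subspaces $B\subset A$ of $L^2$, write $A\ominus B$ for the orthogonal complement of $B$ in $A$. Write $\det\phi=\tilde g/g$ on $\mathbb{D}^2$, where $g,\tilde g\in\mathbb{C}[z_1,z_2]$ have no common factor and $g$ has no zeros in $\mathbb{D}^2$, and let $\deg_j\tilde g$ be the degree of $\tilde g$ in the variable $z_j$. Then the following spaces are finite dimensional and \[ \dim(\mathcal{K}^1_\phi\ominus Z_1\mathcal{K}_\phi)=\dim(\mathcal{K}^1_\phi\ominus\mathcal{K}_\phi)=\deg_2\tilde g, \] \[ \dim(\mathcal{K}^2_\phi\ominus Z_2\mathcal{K}_\phi)=\dim(\mathcal{K}^2_\phi\ominus\mathcal{K}_\phi)=\deg_1\tilde g. \] -/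

import Mathlib

open MeasureTheory Filter Topology

noncomputable section

namespace Bidisk

/-- The open unit bidisk in `ℂ²`; the coordinates `z₁, z₂` have the indices `0, 1`. -/
def bidisk : Set (Fin 2 → ℂ) := {z | ∀ j, ‖z j‖ < 1}

/-- Normalized Lebesgue (Haar) measure on the two-dimensional torus. The parameter `t` in
`UnitAddTorus (Fin 2)` stands for the point `(exp (2πi t₁), exp (2πi t₂))`. -/
def torusMeasure : Measure (UnitAddTorus (Fin 2)) :=
  Measure.pi fun _ => AddCircle.haarAddCircle

instance : IsProbabilityMeasure torusMeasure := by
  unfold torusMeasure; infer_instance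

/-- The point of `(∂𝔻)²` with parameter `t`. -/
def torusPoint (t : UnitAddTorus (Fin 2)) : Fin 2 → ℂ :=
  fun j => (AddCircle.toCircle (t j) : ℂ)

/-- `L² = L²(𝕋²) ⊗ ℂᴺ`. -/
abbrev L2 (N : ℕ) : Type := Lp (EuclideanSpace ℂ (Fin N)) 2 torusMeasure

lemma integrable_mFourier_smul {N : ℕ} (f : L2 N) (n : Fin 2 → ℤ) :
    Integrable (fun t => UnitAddTorus.mFourier n t • f t) torusMeasure := by
  have hf : Integrable f torusMeasure :=
    (Lp.memLp f).integrable (by norm_num)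
  refine hf.bdd_smul ‖UnitAddTorus.mFourier (d := Fin 2) n‖
    (UnitAddTorus.mFourier n).continuous.aestronglyMeasurable ?_
  exact Eventually.of_forall fun t => (UnitAddTorus.mFourier n).norm_coe_le_norm t

lemma mFourierCoeff_eq {N : ℕ} (f : UnitAddTorus (Fin 2) → EuclideanSpace ℂ (Fin N))
    (n : Fin 2 → ℤ) :
    UnitAddTorus.mFourierCoeff f n =
      ∫ t, UnitAddTorus.mFourier (-n) t • f t ∂torusMeasure := rfl

/-- The functions in `L²` whose Fourier coefficients vanish off the set `S` of indices. -/
def fourierSupported (N : ℕ) (S : Set (Fin 2 → ℤ)) : Submodule ℂ (L2 N) where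
  carrier := {f | ∀ n, n ∉ S → UnitAddTorus.mFourierCoeff f n = 0}
  zero_mem' := by
    intro n _
    rw [mFourierCoeff_eq]
    refine integral_eq_zero_of_ae ?_
    filter_upwards [Lp.coeFn_zero (EuclideanSpace ℂ (Fin N)) 2 torusMeasure] with t ht
    rw [ht]; simp
  add_mem' := by
    intro f g hf hg n hn
    have h1 := hf n hn
    have h2 := hg n hn
    rw [mFourierCoeff_eq] at h1 h2 ⊢
    have : ∫ t, UnitAddTorus.mFourier (-n) t • (f + g : L2 N) t ∂torusMeasure =
        ∫ t, (UnitAddTorus.mFourier (-n) t • f t + UnitAddTorus.mFourier (-n) t • g t)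
          ∂torusMeasure := by
      refine integral_congr_ae ?_
      filter_upwards [Lp.coeFn_add f g] with t ht
      rw [ht, Pi.add_apply, smul_add]
    rw [this, integral_add (integrable_mFourier_smul f _) (integrable_mFourier_smul g _),
      h1, h2, add_zero]
  smul_mem' := by
    intro c f hf n hn
    have h1 := hf n hn
    rw [mFourierCoeff_eq] at h1 ⊢
    have : ∫ t, UnitAddTorus.mFourier (-n) t • (c • f : L2 N) t ∂torusMeasure =
        ∫ t, c • (UnitAddTorus.mFourier (-n) t • f t) ∂torusMeasure := by
      refine integral_congr_ae ?_
      filter_upwards [Lp.coeFn_smul c f] with t ht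
      rw [ht, Pi.smul_apply, smul_comm]
    rw [this, integral_smul, h1, smul_zero]

/-- The Hardy space `H²`: Fourier support in `ℤ₊ × ℤ₊`. -/
def hardy (N : ℕ) : Submodule ℂ (L2 N) := fourierSupported N {n | ∀ j, 0 ≤ n j}

/-- `L²₋₋`: Fourier support in `ℤ₋ × ℤ₋`, where `ℤ₋ = {-1, -2, …}`. -/
def L2negNeg (N : ℕ) : Submodule ℂ (L2 N) := fourierSupported N {n | ∀ j, n j < 0}

/-- `M S = {M h : h ∈ S} ∩ L²` for a matrix function `M` on the torus and a subspace `S` of `L²`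
(for `M` unitary almost everywhere, `M h` is automatically in `L²`). -/
def mulImage {N : ℕ} (M : UnitAddTorus (Fin 2) → Matrix (Fin N) (Fin N) ℂ)
    (S : Submodule ℂ (L2 N)) : Submodule ℂ (L2 N) where
  carrier := {f | ∃ h ∈ S, ∀ᵐ t ∂torusMeasure, f t = Matrix.toEuclideanLin (M t) (h t)}
  zero_mem' := by
    refine ⟨0, S.zero_mem, ?_⟩
    filter_upwards [Lp.coeFn_zero (EuclideanSpace ℂ (Fin N)) 2 torusMeasure] with t ht
    rw [ht]; simp
  add_mem' := by
    rintro f g ⟨h, hh, hf⟩ ⟨k, hk, hg⟩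
    refine ⟨h + k, S.add_mem hh hk, ?_⟩
    filter_upwards [hf, hg, Lp.coeFn_add f g, Lp.coeFn_add h k] with t h1 h2 h3 h4
    rw [h3, h4, Pi.add_apply, Pi.add_apply, map_add, h1, h2]
  smul_mem' := by
    rintro c f ⟨h, hh, hf⟩
    refine ⟨c • h, S.smul_mem c hh, ?_⟩
    filter_upwards [hf, Lp.coeFn_smul c f, Lp.coeFn_smul c h] with t h1 h2 h3
    rw [h2, h3, Pi.smul_apply, Pi.smul_apply, map_smul, h1]

/-- `Z_j S`: the image of the subspace `S` under multiplication by the coordinate `z_j`. -/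
def shift {N : ℕ} (j : Fin 2) (S : Submodule ℂ (L2 N)) : Submodule ℂ (L2 N) :=
  mulImage (fun t => Matrix.scalar (Fin N) (torusPoint t j)) S

/-- The radial boundary value `lim_{r ↗ 1} φ(r e^{iθ₁}, r e^{iθ₂})`. -/
def boundaryValue {N : ℕ} (φ : (Fin 2 → ℂ) → Matrix (Fin N) (Fin N) ℂ)
    (t : UnitAddTorus (Fin 2)) : Matrix (Fin N) (Fin N) ℂ :=
  limUnder (𝓝[<] (1 : ℝ)) fun r : ℝ => φ ((r : ℂ) • torusPoint t)

/-- Matrix inner functions on the bidisk: holomorphic, with values in the closed unit ball for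
the operator norm, and with unitary radial boundary values almost everywhere on the torus. -/
structure IsInner {N : ℕ} (φ : (Fin 2 → ℂ) → Matrix (Fin N) (Fin N) ℂ) : Prop where
  differentiableOn : ∀ i j, DifferentiableOn ℂ (fun z => φ z i j) bidisk
  norm_le_one : ∀ z ∈ bidisk, ‖Matrix.toEuclideanCLM (𝕜 := ℂ) (φ z)‖ ≤ 1
  tendsto_boundaryValue : ∀ᵐ t ∂torusMeasure,
    Tendsto (fun r : ℝ => φ ((r : ℂ) • torusPoint t)) (𝓝[<] (1 : ℝ)) (𝓝 (boundaryValue φ t))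
  unitary_boundaryValue : ∀ᵐ t ∂torusMeasure,
    boundaryValue φ t ∈ Matrix.unitaryGroup (Fin N) ℂ

/-- `K_φ = H² ∩ φ L²₋₋`. -/
def K {N : ℕ} (φ : (Fin 2 → ℂ) → Matrix (Fin N) (Fin N) ℂ) : Submodule ℂ (L2 N) :=
  hardy N ⊓ mulImage (boundaryValue φ) (L2negNeg N)

/-- `K_φ^j = H² ∩ Z_j φ L²₋₋`, where the index `j : Fin 2` is `0` for `z₁` and `1` for `z₂`. -/
def Ksup {N : ℕ} (j : Fin 2) (φ : (Fin 2 → ℂ) → Matrix (Fin N) (Fin N) ℂ) :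
    Submodule ℂ (L2 N) :=
  hardy N ⊓ shift j (mulImage (boundaryValue φ) (L2negNeg N))

/-- `A ⊖ B`: the vectors of `A` orthogonal to `B`. -/
def ominus {N : ℕ} (A B : Submodule ℂ (L2 N)) : Submodule ℂ (L2 N) := A ⊓ Bᗮ

end Bidisk

end

/-! Fix an index `j` and let `k` be the other one. Multiplication by the boundary values of `φ` is a
unitary `V` on `L²` that commutes with `Z = Z_j`. Put `M = {n_k ≥ 0} ∩ V {n_k < 0}`, a reducing
subspace for `Z`, and `A = {n_j ≥ 0}`, `B = V {n_j ≤ 0}`. Then `K^j = M ∩ A ∩ B`, `Z K = Z (M ∩ A) ∩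
B` and `K = Z⁻¹ (M ∩ B) ∩ A`. The crucial fact is that a vector of `M` orthogonal to `Z (M ∩ A)`
lies in `B`, and dually a vector of `M` orthogonal to `Z⁻¹ (M ∩ B)` lies in `A`
(`mem_coanalytic_of_orthogonal`, `mem_analytic_of_orthogonal`). Hence `K^j ⊖ Z K = (M ∩ A) ⊖ Z (M ∩
A)` and `K^j ⊖ K = (M ∩ B) ⊖ Z⁻¹ (M ∩ B)`, and each of these is a wandering subspace `W` with `M = ⨁
Zⁿ W`, the sum being over all integers `n`.

For such a `W`, Parseval's identity gives `dim W = ∑ ‖P_M e‖²` over the basis vectors `e` with `n_j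
= 0` (`rank_wandering`). This depends on `M` only, so both dimensions agree. The projections of
basis vectors onto `M` are explicit, and the sum is `∑ n_k⁺ ‖a n‖²`, where `a n` are the matrix
Fourier coefficients of `φ` with the Hilbert–Schmidt norm (`trace_eq`).

By Parseval in `z_j` and Tonelli, the last sum is the integral over `|x| = 1` of the same
one-variable sum for the slice `F = φ(x, ·)` in `z_k` (`UnitaryAE.tsum_mFourierCoeff`). For a
rational inner `F` that sum is the Dirichlet integral of `tr (F* z F')`; since `F` is unitary on the
circle, `tr (F* F') = (det F)' / det F`, so the sum is the winding number of `det F`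
(`tsum_fourierCoeff_ratEval`). For almost every `x` the slices of `g̃` and `g` are coprime, that of
`g` has no zeros in the disk, and that of `g̃` has degree `deg_k g̃`. Unimodularity then forces all
zeros of the slice of `g̃` into the open disk, and the winding number is `deg_k g̃` (`ae_slice`). -/

noncomputable section
namespace Bidisk

open scoped ENNReal InnerProductSpace

/-- Parseval's identity with values in `ℝ≥0∞`. -/
lemma enorm_sq_eq_tsum {ι E : Type*} [NormedAddCommGroup E] [InnerProductSpace ℂ E]
    (b : HilbertBasis ι ℂ E) (x : E) : ‖x‖ₑ ^ 2 = ∑' i, ‖⟪b i, x⟫_ℂ‖ₑ ^ 2 := by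
  have h := b.hasSum_inner_mul_inner x x
  have h2 : HasSum (fun i => ‖⟪b i, x⟫_ℂ‖ ^ 2) (‖x‖ ^ 2) := by
    have h3 := Complex.hasSum_re h
    convert! h3 using 2 with i
    · rw [← inner_conj_symm x (b i), ← Complex.normSq_eq_conj_mul_self, Complex.ofReal_re,
        Complex.normSq_eq_norm_sq]
    · rw [inner_self_eq_norm_sq_to_K]; norm_cast
  have h4 := ENNReal.ofReal_tsum_of_nonneg (fun i => by positivity) h2.summable
  rw [h2.tsum_eq] at h4
  simpa only [ENNReal.ofReal_pow (norm_nonneg _), ofReal_norm] using h4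

/-! ### Wandering subspaces of a unitary and a trace formula for their dimension -/

section Wandering

variable {H ι : Type*} [NormedAddCommGroup H] [InnerProductSpace ℂ H] [CompleteSpace H]

/-- Splitting a vector along a closed subspace. -/
lemma exists_add_orthogonal (S : Submodule ℂ H) (hS : IsClosed (S : Set H)) (f : H) :
    ∃ s ∈ S, ∃ w ∈ Sᗮ, f = s + w := by
  have : CompleteSpace S := hS.completeSpace_coe
  exact S.exists_add_mem_mem_orthogonal f

lemma inner_map_eq_symm (U : H ≃ₗᵢ[ℂ] H) (x y : H) : ⟪U x, y⟫_ℂ = ⟪x, U.symm y⟫_ℂ := by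
  rw [← U.inner_map_map x, U.apply_symm_apply]

lemma isClosed_map_equiv (U : H ≃ₗᵢ[ℂ] H) (S : Submodule ℂ H) (hS : IsClosed (S : Set H)) :
    IsClosed (S.map (U.toLinearEquiv : H →ₗ[ℂ] H) : Set H) := by
  rw [Submodule.map_coe]
  exact U.toHomeomorph.isClosedMap _ hS

/-- The hypotheses on a unitary `U` and closed subspaces `M`, `A`, `B` under which
`(M ∩ A) ⊖ U (M ∩ A)` is contained in `B` and is a wandering subspace generating `M`. -/
structure WanderingData (U : H ≃ₗᵢ[ℂ] H) (M A B : Submodule ℂ H) : Prop where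
  closedM : IsClosed (M : Set H)
  closedA : IsClosed (A : Set H)
  map_M : ∀ f ∈ M, U f ∈ M
  symm_M : ∀ f ∈ M, U.symm f ∈ M
  map_A : ∀ f ∈ A, U f ∈ A
  mem_B : ∀ f ∈ M, (∀ g ∈ M ⊓ A, ⟪U g, f⟫_ℂ = 0) → f ∈ B
  pureA : ∀ f, (∀ n : ℕ, (U.symm)^[n] f ∈ A) → f = 0
  pureB : ∀ f, (∀ n : ℕ, U^[n] f ∈ B) → f = 0

/-- `(M ∩ A ∩ B) ⊖ (M ∩ U A ∩ B)`. -/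
def wandering (U : H ≃ₗᵢ[ℂ] H) (M A B : Submodule ℂ H) : Submodule ℂ H :=
  (M ⊓ A ⊓ B) ⊓ ((M ⊓ A).map (U.toLinearEquiv : H →ₗ[ℂ] H) ⊓ B)ᗮ

variable {U : H ≃ₗᵢ[ℂ] H} {M A B : Submodule ℂ H}

namespace WanderingData

lemma closed_inf (h : WanderingData U M A B) : IsClosed ((M ⊓ A : Submodule ℂ H) : Set H) :=
  h.closedM.inter h.closedA

lemma map_inf (h : WanderingData U M A B) {f : H} (hf : f ∈ M ⊓ A) : U f ∈ M ⊓ A :=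
  ⟨h.map_M f hf.1, h.map_A f hf.2⟩

/-- One step of a Wold decomposition: `f` is projected onto the closed subspace `U (M ∩ A)`, and the
remainder falls into `B` by `mem_B`. -/
lemma exists_decomp (h : WanderingData U M A B) (f : H) (hf : f ∈ M ⊓ A) :
    ∃ g ∈ M ⊓ A, ∃ w ∈ M ⊓ A, f = U g + w ∧ w ∈ B ∧ ∀ g ∈ M ⊓ A, ⟪U g, w⟫_ℂ = 0 := by
  obtain ⟨s, ⟨g, hg, rfl⟩, w, hw, hfw⟩ :=
    exists_add_orthogonal _ (isClosed_map_equiv U _ h.closed_inf) f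
  have hfw' : f = U g + w := hfw
  have hw2 : ∀ g ∈ M ⊓ A, ⟪U g, w⟫_ℂ = 0 := fun g hg => hw _ ⟨g, hg, rfl⟩
  have hw1 : w ∈ M ⊓ A := by
    have : w = f - U g := by rw [hfw']; abel
    rw [this]; exact sub_mem hf (h.map_inf hg)
  exact ⟨g, hg, w, hw1, hfw', h.mem_B w hw1.1 hw2, hw2⟩

/-- The intersections with `B` in `wandering` cost nothing. If `f = U g + w` is the Wold step and `f
∈ B`, then `U g = f - w` is also in `B`, so `f ⊥ U g` and `U g = 0`. -/
lemma mem_wandering (h : WanderingData U M A B) (f : H) :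
    f ∈ wandering U M A B ↔ f ∈ M ⊓ A ∧ ∀ g ∈ M ⊓ A, ⟪U g, f⟫_ℂ = 0 := by
  constructor
  · rintro ⟨⟨hf, hfB⟩, hfo⟩
    refine ⟨hf, ?_⟩
    obtain ⟨g, hg, w, hw, hfw, hwB, hwo⟩ := h.exists_decomp f hf
    have hUg : U g ∈ B := by
      have : U g = f - w := by rw [hfw]; abel
      rw [this]; exact sub_mem hfB hwB
    have h1 : ⟪U g, f⟫_ℂ = 0 := hfo _ ⟨⟨g, hg, rfl⟩, hUg⟩
    rw [hfw, inner_add_right, hwo g hg, add_zero, inner_self_eq_zero] at h1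
    rw [hfw, h1, zero_add]; exact hwo
  · rintro ⟨hf, hfo⟩
    refine ⟨⟨hf, h.mem_B f hf.1 hfo⟩, ?_⟩
    rintro _ ⟨⟨g, hg, rfl⟩, -⟩
    exact hfo g hg

lemma isClosed_wandering (h : WanderingData U M A B) :
    IsClosed (wandering U M A B : Set H) := by
  have : wandering U M A B = (M ⊓ A) ⊓ ((M ⊓ A).map (U.toLinearEquiv : H →ₗ[ℂ] H))ᗮ := by
    ext f
    rw [h.mem_wandering, Submodule.mem_inf (p := M ⊓ A), Submodule.mem_orthogonal]
    refine and_congr_right fun _ => ⟨?_, fun h1 g hg => h1 _ ⟨g, hg, rfl⟩⟩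
    rintro h1 _ ⟨g, hg, rfl⟩
    exact h1 g hg
  rw [this]
  exact h.closed_inf.inter (Submodule.isClosed_orthogonal _)

lemma iterate_mem (h : WanderingData U M A B) (n : ℕ) {f : H} (hf : f ∈ M ⊓ A) :
    U^[n] f ∈ M ⊓ A := by
  induction n with
  | zero => exact hf
  | succ n ih => rw [Function.iterate_succ_apply']; exact h.map_inf ih

lemma eq_map_of_orthogonal (h : WanderingData U M A B) {s : H} (hs : s ∈ M ⊓ A)
    (hso : ∀ w ∈ wandering U M A B, ⟪w, s⟫_ℂ = 0) : ∃ g ∈ M ⊓ A, s = U g := by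
  obtain ⟨g, hg, w, hw, hfw, hwB, hwo⟩ := h.exists_decomp s hs
  have h1 := hso w ((h.mem_wandering w).2 ⟨hw, hwo⟩)
  rw [hfw, inner_add_right, ← inner_conj_symm, hwo g hg, map_zero, zero_add,
    inner_self_eq_zero] at h1
  exact ⟨g, hg, by rw [hfw, h1, add_zero]⟩

/-- Wold's argument: orthogonality to the wandering subspace allows `U` to be divided out within `M
∩ A`, and the quotient is again orthogonal to all iterates. Infinite divisibility contradicts
`pureA` unless the vector is zero. -/
lemma eq_zero_of_orthogonal_iterate (h : WanderingData U M A B) {s : H} (hs : s ∈ M ⊓ A)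
    (hso : ∀ n : ℕ, ∀ w ∈ wandering U M A B, ⟪U^[n] w, s⟫_ℂ = 0) : s = 0 := by
  have key : ∀ n : ℕ, ∀ s ∈ M ⊓ A,
      (∀ n : ℕ, ∀ w ∈ wandering U M A B, ⟪U^[n] w, s⟫_ℂ = 0) → (U.symm)^[n] s ∈ A := by
    intro n
    induction n with
    | zero => intro s hs _; exact hs.2
    | succ n ih =>
      intro s hs hso
      obtain ⟨g, hg, rfl⟩ := h.eq_map_of_orthogonal hs (hso 0)
      rw [Function.iterate_succ_apply, U.symm_apply_apply]
      refine ih g hg fun m w hw => ?_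
      have := hso (m + 1) w hw
      rwa [Function.iterate_succ_apply', U.inner_map_map] at this
  exact h.pureA s fun n => key n s hs hso

lemma zpow_mem (h : WanderingData U M A B) (k : ℤ) {f : H} (hf : f ∈ M) : (U ^ k) f ∈ M := by
  induction k using Int.induction_on with
  | zero => simpa using hf
  | succ n ih =>
    rw [add_comm, zpow_add, zpow_one]; exact h.map_M _ ih
  | pred n ih =>
    rw [sub_eq_add_neg, add_comm, zpow_add, zpow_neg_one]; exact h.symm_M _ ih

lemma iterate_eq_zpow (U : H ≃ₗᵢ[ℂ] H) (n : ℕ) (f : H) : U^[n] f = (U ^ (n : ℤ)) f := by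
  induction n with
  | zero => simp
  | succ n ih =>
    rw [Function.iterate_succ_apply', ih, Nat.cast_succ, add_comm, zpow_add, zpow_one]; rfl

lemma zpow_add_apply (U : H ≃ₗᵢ[ℂ] H) (k l : ℤ) (x : H) :
    (U ^ (k + l)) x = (U ^ k) ((U ^ l) x) := by
  rw [zpow_add]; rfl

lemma zpow_zero_apply (U : H ≃ₗᵢ[ℂ] H) (x : H) : (U ^ (0 : ℤ)) x = x := by
  rw [zpow_zero]; rfl

lemma inner_zpow_zpow (U : H ≃ₗᵢ[ℂ] H) (k l : ℤ) (x y : H) :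
    ⟪(U ^ k) x, (U ^ l) y⟫_ℂ = ⟪(U ^ (k - l)) x, y⟫_ℂ := by
  rw [← (U ^ (-l)).inner_map_map, ← zpow_add_apply, ← zpow_add_apply, neg_add_cancel,
    zpow_zero_apply, neg_add_eq_sub]

lemma eq_zero_of_orthogonal_zpow (h : WanderingData U M A B) {f : H} (hf : f ∈ M)
    (hfo : ∀ k : ℤ, ∀ w ∈ wandering U M A B, ⟪(U ^ k) w, f⟫_ℂ = 0) : f = 0 := by
  -- Only the forward iterates are needed to reach `B`: the component of `f` in `M ∩ A` vanishes by
  -- the previous lemma, so `f` is orthogonal to `M ∩ A`, in particular to `U (M ∩ A)`.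
  have key : ∀ f ∈ M, (∀ n : ℕ, ∀ w ∈ wandering U M A B, ⟪U^[n] w, f⟫_ℂ = 0) → f ∈ B := by
    intro f hf hfo
    obtain ⟨s, hs, w, hw, hfw⟩ := exists_add_orthogonal _ h.closed_inf f
    have hs0 : s = 0 := by
      refine h.eq_zero_of_orthogonal_iterate hs fun n x hx => ?_
      have h1 := hfo n x hx
      rwa [hfw, inner_add_right,
        hw _ (h.iterate_mem n ((h.mem_wandering x).1 hx).1), add_zero] at h1
    rw [hs0, zero_add] at hfw
    subst hfw
    exact h.mem_B f hf fun g hg => hw _ (h.map_inf hg)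
  -- The hypothesis over all of `ℤ` is invariant under `U`, so `key` applies to every `U^n f`.
  refine h.pureB f fun n => ?_
  rw [iterate_eq_zpow]
  refine key _ (h.zpow_mem n hf) fun m w hw => ?_
  rw [iterate_eq_zpow, ← inner_conj_symm, inner_zpow_zpow]
  have h1 := hfo (m - n) w hw
  have h2 := inner_zpow_zpow U 0 (m - n) f w
  rw [zpow_zero_apply, ← inner_conj_symm, h1, map_zero] at h2
  rw [show (n : ℤ) - m = 0 - (m - n) by ring, ← h2, map_zero]

/-- The dimension of the wandering subspace as a trace of the projection onto `M`. -/
theorem rank_wandering (h : WanderingData U M A B) [M.HasOrthogonalProjection]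
    (ε : HilbertBasis (ℤ × ι) ℂ H)
    (hε : ∀ k i, ε (k, i) = (U ^ k) (ε (0, i))) (d : ℕ)
    (hd : ∑' i, ‖M.starProjection (ε (0, i))‖ₑ ^ 2 = d) :
    Module.rank ℂ (wandering U M A B) = d := by
  have : CompleteSpace (wandering U M A B) := h.isClosed_wandering.completeSpace_coe
  have : CompleteSpace M := h.closedM.completeSpace_coe
  obtain ⟨J, w, -⟩ := exists_hilbertBasis ℂ (wandering U M A B)
  have hwM : ∀ c, ((w c : wandering U M A B) : H) ∈ M := fun c => (w c).2.1.1.1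
  let v : ℤ × J → M := fun q => ⟨(U ^ q.1) (w q.2), h.zpow_mem _ (hwM _)⟩
  have hv0 : ∀ (n : ℕ) (x y : wandering U M A B), ⟪(U ^ ((n : ℤ) + 1)) (x : H), (y : H)⟫_ℂ = 0 := by
    intro n x y
    have hx := ((h.mem_wandering _).1 x.2).1
    have hy := ((h.mem_wandering _).1 y.2).2
    have := hy _ (h.iterate_mem n hx)
    rw [iterate_eq_zpow] at this
    rwa [add_comm, zpow_add_apply, zpow_one]
  have hv1 : ∀ (k : ℤ) (x y : wandering U M A B), k ≠ 0 → ⟪(U ^ k) (x : H), (y : H)⟫_ℂ = 0 := by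
    intro k x y hk
    rcases lt_or_gt_of_ne hk with hk | hk
    · obtain ⟨n, hn⟩ := Int.eq_ofNat_of_zero_le (show 0 ≤ -k - 1 by omega)
      have h1 := hv0 n y x
      rw [← hn, show -k - 1 + 1 = 0 - k by ring, ← inner_zpow_zpow, zpow_zero_apply] at h1
      rw [← inner_conj_symm, h1, map_zero]
    · obtain ⟨n, hn⟩ := Int.eq_ofNat_of_zero_le (show 0 ≤ k - 1 by omega)
      have h1 := hv0 n x y
      rwa [← hn, sub_add_cancel] at h1
  have hv : Orthonormal ℂ v := by
    classical
    rw [orthonormal_iff_ite]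
    rintro ⟨k, a⟩ ⟨l, b⟩
    have h1 : ⟪v (k, a), v (l, b)⟫_ℂ = ⟪(U ^ (k - l)) (w a : H), (w b : H)⟫_ℂ :=
      inner_zpow_zpow U k l _ _
    rw [h1]
    by_cases hkl : k = l
    · subst hkl
      rw [sub_self, zpow_zero_apply]
      have h2 := (orthonormal_iff_ite.1 w.orthonormal) a b
      rw [Submodule.coe_inner] at h2
      rw [h2]; simp
    · rw [hv1 _ _ _ (sub_ne_zero.2 hkl), if_neg (by simp [hkl])]
  -- The translates of an orthonormal basis of the wandering subspace span a dense subspace of `M`: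
  -- orthogonality to the basis passes to the whole wandering subspace through the basis expansion.
  have hvsp : (Submodule.span ℂ (Set.range v))ᗮ = ⊥ := by
    rw [Submodule.eq_bot_iff]
    intro x hx
    have hx' : ∀ (k : ℤ) c, ⟪(U ^ k) (w c : H), (x : H)⟫_ℂ = 0 := fun k c =>
      hx (v (k, c)) (Submodule.subset_span ⟨(k, c), rfl⟩)
    refine Subtype.ext (h.eq_zero_of_orthogonal_zpow x.2 fun k y hy => ?_)
    have h1 := w.hasSum_repr ⟨y, hy⟩
    have h2 : HasSum (fun c => (w.repr ⟨y, hy⟩ c • w c : wandering U M A B).1) y :=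
      h1.mapL (wandering U M A B).subtypeL
    have h3 := (h2.mapL ((U ^ k : H ≃ₗᵢ[ℂ] H).toContinuousLinearEquiv : H →L[ℂ] H)).mapL
      (innerSL ℂ (x : H))
    rw [← inner_conj_symm]
    have h4 : ⟪(x : H), (U ^ k) y⟫_ℂ = 0 := by
      refine h3.unique ?_
      convert! hasSum_zero using 2 with c
      have h5 := hx' k c
      rw [← inner_conj_symm, map_eq_zero] at h5
      have h6 : ⟪(x : H), (U ^ k) ((w.repr ⟨y, hy⟩ c) • (w c : H))⟫_ℂ = 0 := by
        rw [map_smul, inner_smul_right, h5, mul_zero]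
      exact h6
    rw [h4, map_zero]
  let b := HilbertBasis.mkOfOrthogonalEqBot hv hvsp
  have hb : ∀ q, b q = v q := fun q => by simp [b]
  have hproj : ∀ x : H, ‖M.starProjection x‖ₑ ^ 2 =
      ∑' q : ℤ × J, ‖⟪(U ^ q.1) (w q.2 : H), x⟫_ℂ‖ₑ ^ 2 := by
    intro x
    have h1 := enorm_sq_eq_tsum b (M.orthogonalProjectionOnto x)
    have h2 : ‖M.starProjection x‖ₑ = ‖M.orthogonalProjectionOnto x‖ₑ := rfl
    rw [h2, h1]
    refine tsum_congr fun q => ?_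
    rw [hb, Submodule.inner_orthogonalProjectionOnto_eq_of_mem_left]
  -- The cardinality of the basis is computed by a double Parseval sum: expand each `‖w c‖² = 1` in
  -- `ε`, move `U^k` to the other side of the inner product, and recognize `‖P_M ε(0, i)‖²` in the
  -- sum over `k` and `c`. In `ℝ≥0∞` the exchanges are free, and finiteness is a conclusion.
  have hcard : (ENat.card J : ℝ≥0∞) = d := by
    rw [← hd]
    calc (ENat.card J : ℝ≥0∞) = ∑' c : J, ‖(w c : H)‖ₑ ^ 2 := by
          have : ∀ c, ‖(w c : H)‖ₑ ^ 2 = 1 := by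
            intro c
            have : ‖(w c : H)‖ = 1 := w.orthonormal.1 c
            rw [← ofReal_norm, this]; simp
          simp [this, ENNReal.tsum_const]
      _ = ∑' c : J, ∑' q : ℤ × ι, ‖⟪ε q, (w c : H)⟫_ℂ‖ₑ ^ 2 :=
          tsum_congr fun c => enorm_sq_eq_tsum ε _
      _ = ∑' c : J, ∑' i : ι, ∑' k : ℤ, ‖⟪ε (k, i), (w c : H)⟫_ℂ‖ₑ ^ 2 :=
          tsum_congr fun c => by
            rw [ENNReal.tsum_comm,
              ENNReal.tsum_prod (f := fun k i => ‖⟪ε (k, i), (w c : H)⟫_ℂ‖ₑ ^ 2)]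
      _ = ∑' i : ι, ∑' c : J, ∑' k : ℤ, ‖⟪ε (k, i), (w c : H)⟫_ℂ‖ₑ ^ 2 := ENNReal.tsum_comm
      _ = _ := by
          refine tsum_congr fun i => ?_
          rw [hproj, ENNReal.tsum_prod
            (f := fun (k : ℤ) c => ‖⟪(U ^ k) (w c : H), ε (0, i)⟫_ℂ‖ₑ ^ 2), ENNReal.tsum_comm]
          -- Moving `U^k` across the inner product turns it into `U^(-k)`, hence the reindexing.
          rw [← (Equiv.neg ℤ).tsum_eq]
          refine tsum_congr fun k => tsum_congr fun c => ?_
          rw [hε, ← inner_conj_symm, RCLike.enorm_conj, Equiv.neg_apply]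
          have := inner_zpow_zpow U 0 (-k) (w c : H) (ε (0, i))
          rw [zpow_zero_apply] at this
          rw [this, zero_sub, neg_neg]
  have hcard' : ENat.card J = d := by exact_mod_cast hcard
  have : Finite J := by
    rw [← ENat.card_lt_top]
    rw [hcard']; exact ENat.coe_lt_top d
  have : Fintype J := Fintype.ofFinite J
  rw [rank_eq_card_basis w.toOrthonormalBasis.toBasis]
  rw [ENat.card_eq_coe_fintype_card] at hcard'
  exact_mod_cast hcard'

end WanderingData
end Wandering
end Bidisk
end

noncomputable section
namespace Bidisk

open scoped ENNReal InnerProductSpace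

/-! ### Subspaces given by the support of the coefficients -/

section Support

variable {H ι : Type*} [NormedAddCommGroup H] [InnerProductSpace ℂ H]

/-- The vectors whose coefficients in the basis `e` vanish off `S`. -/
def coeffSupported (e : HilbertBasis ((Fin 2 → ℤ) × ι) ℂ H) (S : Set (Fin 2 → ℤ)) :
    Submodule ℂ H where
  carrier := {f | ∀ n ∉ S, ∀ i, ⟪e (n, i), f⟫_ℂ = 0}
  zero_mem' := fun n _ i => inner_zero_right _
  add_mem' := fun hf hg n hn i => by rw [inner_add_right, hf n hn i, hg n hn i, add_zero]
  smul_mem' := fun c f hf n hn i => by rw [inner_smul_right, hf n hn i, mul_zero]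

variable {e : HilbertBasis ((Fin 2 → ℤ) × ι) ℂ H} {S T : Set (Fin 2 → ℤ)}

lemma isClosed_coeffSupported (e : HilbertBasis ((Fin 2 → ℤ) × ι) ℂ H) (S : Set (Fin 2 → ℤ)) :
    IsClosed (coeffSupported e S : Set H) := by
  have : (coeffSupported e S : Set H) =
      ⋂ n ∈ Sᶜ, ⋂ i, {f | ⟪e (n, i), f⟫_ℂ = 0} := by
    ext f; simp [coeffSupported]
  rw [this]
  refine isClosed_biInter fun n _ => isClosed_iInter fun i => ?_
  exact isClosed_eq (by fun_prop) continuous_const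

lemma inner_basis_eq_zero (e : HilbertBasis ((Fin 2 → ℤ) × ι) ℂ H) {m n : Fin 2 → ℤ}
    (h : m ≠ n) (i l : ι) : ⟪e (m, i), e (n, l)⟫_ℂ = 0 :=
  e.orthonormal.2 fun h' => h (congrArg Prod.fst h')

lemma basis_mem_coeffSupported {n : Fin 2 → ℤ} (hn : n ∈ S) (i : ι) :
    e (n, i) ∈ coeffSupported e S :=
  fun _ hm _ => inner_basis_eq_zero e (by rintro rfl; exact hm hn) _ _

lemma inner_eq_zero_of_disjoint (hST : Disjoint S T) {x y : H} (hx : x ∈ coeffSupported e S)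
    (hy : y ∈ coeffSupported e T) : ⟪x, y⟫_ℂ = 0 := by
  refine (e.hasSum_inner_mul_inner x y).unique ?_
  convert! hasSum_zero using 2 with q
  by_cases hq : q.1 ∈ S
  · rw [hy q.1 (fun h => Set.disjoint_left.1 hST hq h) q.2, mul_zero]
  · rw [← inner_conj_symm, hx q.1 hq q.2, map_zero, zero_mul]

lemma eq_zero_of_coeff {x : H} (h : ∀ n i, ⟪e (n, i), x⟫_ℂ = 0) : x = 0 := by
  refine e.repr.map_eq_zero_iff.1 ?_
  ext q
  rw [e.repr_apply_apply, h]; rfl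

lemma exists_split [CompleteSpace H] (e : HilbertBasis ((Fin 2 → ℤ) × ι) ℂ H)
    (S : Set (Fin 2 → ℤ)) (x : H) :
    ∃ s ∈ coeffSupported e S, ∃ w ∈ coeffSupported e Sᶜ, x = s + w ∧
      (∀ n ∈ S, ∀ i, ⟪e (n, i), s⟫_ℂ = ⟪e (n, i), x⟫_ℂ) ∧
      ∀ n ∉ S, ∀ i, ⟪e (n, i), w⟫_ℂ = ⟪e (n, i), x⟫_ℂ := by
  obtain ⟨s, hs, w, hw, hx⟩ := exists_add_orthogonal _ (isClosed_coeffSupported e S) x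
  have hw' : ∀ n ∈ S, ∀ i, ⟪e (n, i), w⟫_ℂ = 0 := fun n hn i =>
    hw _ (basis_mem_coeffSupported hn i)
  refine ⟨s, hs, w, fun n hn i => hw' n (not_not.1 hn) i, hx, fun n hn i => ?_, fun n hn i => ?_⟩
  · rw [hx, inner_add_right, hw' n hn i, add_zero]
  · rw [hx, inner_add_right, hs n hn i, zero_add]

lemma split_mem {s w x : H} (hs : s ∈ coeffSupported e S) (hw : w ∈ coeffSupported e Sᶜ)
    (hx : x = s + w) (hxT : x ∈ coeffSupported e T) :
    s ∈ coeffSupported e T ∧ w ∈ coeffSupported e T := by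
  have h : ∀ n ∉ T, ∀ i, ⟪e (n, i), s⟫_ℂ + ⟪e (n, i), w⟫_ℂ = 0 := fun n hn i => by
    rw [← inner_add_right, ← hx, hxT n hn i]
  refine ⟨fun n hn i => ?_, fun n hn i => ?_⟩
  · by_cases hS : n ∈ S
    · have := h n hn i
      rwa [hw n (not_not.2 hS) i, add_zero] at this
    · exact hs n hS i
  · by_cases hS : n ∈ S
    · exact hw n (not_not.2 hS) i
    · have := h n hn i
      rwa [hs n hS i, zero_add] at this

end Support

/-- An analytic unitary Toeplitz pair: `Z` is the shift by one in the direction `j`, and `V` is a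
unitary with the Toeplitz matrix `a`, which is supported in the positive quadrant. -/
structure ToeplitzUnitary {H ι : Type*} [NormedAddCommGroup H] [InnerProductSpace ℂ H]
    (e : HilbertBasis ((Fin 2 → ℤ) × ι) ℂ H) (j : Fin 2) (Z V : H ≃ₗᵢ[ℂ] H)
    (a : (Fin 2 → ℤ) → ι → ι → ℂ) : Prop where
  shift_basis : ∀ n i, Z (e (n, i)) = e (n + Pi.single j 1, i)
  comm : ∀ x, V (Z x) = Z (V x)
  inner_eq : ∀ m n l i, ⟪e (m, l), V (e (n, i))⟫_ℂ = a (m - n) l i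
  analytic : ∀ n, (∃ x, n x < 0) → ∀ l i, a n l i = 0

/-! ### Analytic Toeplitz unitaries, their wandering subspaces and the trace -/

namespace ToeplitzUnitary

variable {H ι : Type*} [NormedAddCommGroup H] [InnerProductSpace ℂ H] [CompleteSpace H]
  {e : HilbertBasis ((Fin 2 → ℤ) × ι) ℂ H} {j k : Fin 2} {Z V : H ≃ₗᵢ[ℂ] H}
  {a : (Fin 2 → ℤ) → ι → ι → ℂ}

lemma symm_basis (h : ToeplitzUnitary e j Z V a) (n : Fin 2 → ℤ) (i : ι) :
    Z.symm (e (n, i)) = e (n - Pi.single j 1, i) := by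
  rw [Z.symm_apply_eq, h.shift_basis, sub_add_cancel]

lemma symm_comm (h : ToeplitzUnitary e j Z V a) (x : H) : V.symm (Z x) = Z (V.symm x) := by
  rw [V.symm_apply_eq, h.comm, V.apply_symm_apply]

lemma symm_symm_comm (h : ToeplitzUnitary e j Z V a) (x : H) :
    V.symm (Z.symm x) = Z.symm (V.symm x) := by
  rw [Z.eq_symm_apply, ← h.symm_comm, Z.apply_symm_apply]

lemma inner_shift (h : ToeplitzUnitary e j Z V a) (n : Fin 2 → ℤ) (i : ι) (x : H) :
    ⟪e (n, i), Z x⟫_ℂ = ⟪e (n - Pi.single j 1, i), x⟫_ℂ := by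
  rw [← h.symm_basis, inner_map_eq_symm Z.symm]; rfl

lemma inner_shift_symm (h : ToeplitzUnitary e j Z V a) (n : Fin 2 → ℤ) (i : ι) (x : H) :
    ⟪e (n, i), Z.symm x⟫_ℂ = ⟪e (n + Pi.single j 1, i), x⟫_ℂ := by
  rw [← h.shift_basis, inner_map_eq_symm Z]

lemma inner_symm_eq (h : ToeplitzUnitary e j Z V a) (m n : Fin 2 → ℤ) (l i : ι) :
    ⟪e (m, l), V.symm (e (n, i))⟫_ℂ = starRingEnd ℂ (a (n - m) i l) := by
  rw [← inner_map_eq_symm, ← inner_conj_symm, h.inner_eq]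

/-- The matrix entry from `n` to `m` vanishes unless `n ≤ m`, so `V` preserves supports in upward
closed sets; the adjoint does the same for downward closed sets. -/
lemma map_mem (h : ToeplitzUnitary e j Z V a) {S : Set (Fin 2 → ℤ)}
    (hS : ∀ n ∈ S, ∀ m, n ≤ m → m ∈ S) {x : H} (hx : x ∈ coeffSupported e S) :
    V x ∈ coeffSupported e S := by
  intro m hm l
  have h0 := inner_map_eq_symm V.symm (e (m, l)) x
  rw [LinearIsometryEquiv.symm_symm] at h0
  rw [← h0]
  refine (e.hasSum_inner_mul_inner _ x).unique ?_
  convert! hasSum_zero using 2 with q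
  by_cases hq : q.1 ∈ S
  · have h1 : ∃ x, (m - q.1) x < 0 := by
      by_contra! hc
      exact hm (hS q.1 hq m fun x => by simpa using hc x)
    rw [inner_map_eq_symm V.symm, LinearIsometryEquiv.symm_symm]
    have := h.inner_eq m q.1 l q.2
    rw [h.analytic _ h1] at this
    rw [this, zero_mul]
  · rw [hx q.1 hq q.2, mul_zero]

lemma symm_map_mem (h : ToeplitzUnitary e j Z V a) {S : Set (Fin 2 → ℤ)}
    (hS : ∀ n ∈ S, ∀ m, m ≤ n → m ∈ S) {x : H} (hx : x ∈ coeffSupported e S) :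
    V.symm x ∈ coeffSupported e S := by
  intro m hm l
  rw [← inner_map_eq_symm V]
  refine (e.hasSum_inner_mul_inner _ x).unique ?_
  convert! hasSum_zero using 2 with q
  by_cases hq : q.1 ∈ S
  · have h1 : ∃ x, (q.1 - m) x < 0 := by
      by_contra! hc
      exact hm (hS q.1 hq m fun x => by simpa using hc x)
    have := h.inner_eq q.1 m q.2 l
    rw [h.analytic _ h1] at this
    rw [← inner_conj_symm]
    rw [this, map_zero, zero_mul]
  · rw [hx q.1 hq q.2, mul_zero]

/-- `{n_k ≥ 0} ⊖ V {n_k ≥ 0}`. -/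
def model (e : HilbertBasis ((Fin 2 → ℤ) × ι) ℂ H) (k : Fin 2) (V : H ≃ₗᵢ[ℂ] H) :
    Submodule ℂ H :=
  coeffSupported e {n | 0 ≤ n k} ⊓
    (coeffSupported e {n | n k < 0}).map (V.toLinearEquiv : H →ₗ[ℂ] H)

/-- `V {n_j ≤ 0}`. -/
def coanalytic (e : HilbertBasis ((Fin 2 → ℤ) × ι) ℂ H) (j : Fin 2) (V : H ≃ₗᵢ[ℂ] H) :
    Submodule ℂ H :=
  (coeffSupported e {n | n j ≤ 0}).map (V.toLinearEquiv : H →ₗ[ℂ] H)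

lemma mem_map_equiv (V : H ≃ₗᵢ[ℂ] H) (S : Submodule ℂ H) (x : H) :
    x ∈ S.map (V.toLinearEquiv : H →ₗ[ℂ] H) ↔ V.symm x ∈ S := by
  rw [Submodule.mem_map]
  constructor
  · rintro ⟨y, hy, rfl⟩
    have : V.symm (V y) = y := V.symm_apply_apply y
    exact this.symm ▸ hy
  · intro hx
    exact ⟨V.symm x, hx, V.apply_symm_apply x⟩

lemma mem_model {x : H} : x ∈ model e k V ↔
    x ∈ coeffSupported e {n | 0 ≤ n k} ∧ V.symm x ∈ coeffSupported e {n | n k < 0} := by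
  rw [model, Submodule.mem_inf, mem_map_equiv]

lemma mem_coanalytic {x : H} : x ∈ coanalytic e j V ↔
    V.symm x ∈ coeffSupported e {n | n j ≤ 0} := mem_map_equiv _ _ _

lemma isClosed_model (e : HilbertBasis ((Fin 2 → ℤ) × ι) ℂ H) (k : Fin 2) (V : H ≃ₗᵢ[ℂ] H) :
    IsClosed (model e k V : Set H) :=
  (isClosed_coeffSupported _ _).inter (isClosed_map_equiv V _ (isClosed_coeffSupported _ _))

lemma compl_nonneg (k : Fin 2) : {n : Fin 2 → ℤ | 0 ≤ n k}ᶜ = {n | n k < 0} := by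
  ext n; simp

lemma shift_mem (h : ToeplitzUnitary e j Z V a) {S T : Set (Fin 2 → ℤ)}
    (hST : ∀ n ∈ S, n + Pi.single j 1 ∈ T) {x : H} (hx : x ∈ coeffSupported e S) :
    Z x ∈ coeffSupported e T := fun n hn i => by
  rw [h.inner_shift]
  exact hx _ (fun hn' => hn (by simpa using hST _ hn')) i

lemma shift_symm_mem (h : ToeplitzUnitary e j Z V a) {S T : Set (Fin 2 → ℤ)}
    (hST : ∀ n ∈ S, n - Pi.single j 1 ∈ T) {x : H} (hx : x ∈ coeffSupported e S) :
    Z.symm x ∈ coeffSupported e T := fun n hn i => by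
  rw [h.inner_shift_symm]
  exact hx _ (fun hn' => hn (by simpa using hST _ hn')) i

/-- The model space is cut out by conditions on the coordinate `k` alone, which a shift in direction
`j` does not touch. With the next lemma, it reduces `Z`. -/
lemma map_model (h : ToeplitzUnitary e j Z V a) (hjk : j ≠ k) {x : H} (hx : x ∈ model e k V) :
    Z x ∈ model e k V := by
  rw [mem_model] at hx ⊢
  refine ⟨h.shift_mem ?_ hx.1, ?_⟩
  · intro n hn; simpa [hjk.symm] using hn
  · rw [h.symm_comm]
    refine h.shift_mem ?_ hx.2
    intro n hn; simpa [hjk.symm] using hn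

lemma symm_map_model (h : ToeplitzUnitary e j Z V a) (hjk : j ≠ k) {x : H}
    (hx : x ∈ model e k V) : Z.symm x ∈ model e k V := by
  rw [mem_model] at hx ⊢
  refine ⟨h.shift_symm_mem ?_ hx.1, ?_⟩
  · intro n hn; simpa [hjk.symm] using hn
  · rw [h.symm_symm_comm]
    refine h.shift_symm_mem ?_ hx.2
    intro n hn; simpa [hjk.symm] using hn

lemma inner_iterate_symm (h : ToeplitzUnitary e j Z V a) (N : ℕ) (n : Fin 2 → ℤ) (i : ι) (x : H) :
    ⟪e (n, i), Z.symm^[N] x⟫_ℂ = ⟪e (n + Pi.single j (N : ℤ), i), x⟫_ℂ := by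
  induction N generalizing n with
  | zero => simp
  | succ N ih =>
    rw [Function.iterate_succ_apply', h.inner_shift_symm, ih, add_assoc, ← Pi.single_add,
      Nat.cast_succ, add_comm (1 : ℤ)]

lemma inner_iterate (h : ToeplitzUnitary e j Z V a) (N : ℕ) (n : Fin 2 → ℤ) (i : ι) (x : H) :
    ⟪e (n, i), Z^[N] x⟫_ℂ = ⟪e (n - Pi.single j (N : ℤ), i), x⟫_ℂ := by
  induction N generalizing n with
  | zero => simp
  | succ N ih =>
    rw [Function.iterate_succ_apply', h.inner_shift, ih, sub_sub, ← Pi.single_add,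
      Nat.cast_succ, add_comm (1 : ℤ)]

lemma eq_zero_of_iterate_symm (h : ToeplitzUnitary e j Z V a) (f : H)
    (hf : ∀ n : ℕ, Z.symm^[n] f ∈ coeffSupported e {n | 0 ≤ n j}) : f = 0 := by
  refine eq_zero_of_coeff (e := e) fun m i => ?_
  obtain ⟨N, hN⟩ := exists_nat_gt (m j)
  have h1 := hf N (m - Pi.single j (N : ℤ)) (by simpa using hN) i
  rwa [h.inner_iterate_symm, sub_add_cancel] at h1

lemma eq_zero_of_iterate (h : ToeplitzUnitary e j Z V a) (f : H)
    (hf : ∀ n : ℕ, Z^[n] f ∈ coanalytic e j V) : f = 0 := by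
  rw [← V.symm.map_eq_zero_iff]
  refine eq_zero_of_coeff (e := e) fun m i => ?_
  obtain ⟨N, hN⟩ := exists_nat_gt (-m j)
  have h1 := mem_coanalytic.1 (hf N) (m + Pi.single j (N : ℤ))
    (by simp only [Set.mem_setOf_eq, Pi.add_apply, Pi.single_eq_same]; omega) i
  have h2 : V.symm (Z^[N] f) = Z^[N] (V.symm f) := by
    clear hf hN h1
    induction N with
    | zero => rfl
    | succ N ih => rw [Function.iterate_succ_apply', Function.iterate_succ_apply', h.symm_comm, ih]
  rwa [h2, h.inner_iterate, add_sub_cancel_right] at h1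

/-- It suffices to test `f` against `V e_m` with `m_j > 0` and `m_k < 0`. The part `s` of `V e_m` on
`n_k ≥ 0` lies in `M`, and analyticity keeps its support in `n_j ≥ m_j ≥ 1`; so `s ∈ Z (M ∩ A)` is
orthogonal to `f`. The remaining part is orthogonal to `f` by its support. -/
lemma mem_coanalytic_of_orthogonal (h : ToeplitzUnitary e j Z V a) {f : H}
    (hf : f ∈ model e k V) (hjk : j ≠ k)
    (hfo : ∀ g ∈ model e k V ⊓ coeffSupported e {n | 0 ≤ n j}, ⟪Z g, f⟫_ℂ = 0) :
    f ∈ coanalytic e j V := by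
  rw [mem_coanalytic]
  rw [mem_model] at hf
  intro m hm i
  replace hm : 0 < m j := by simpa using hm
  by_cases hk : 0 ≤ m k
  · exact hf.2 m (by simpa using hk) i
  replace hk : m k < 0 := not_le.1 hk
  obtain ⟨s, hs, w, hw, hx, -⟩ := exists_split e {n | 0 ≤ n k} (V (e (m, i)))
  have hw' := hw
  rw [compl_nonneg] at hw'
  have hs2 : s ∈ coeffSupported e {n | m j ≤ n j} := by
    refine (split_mem hs hw hx (h.map_mem ?_ (basis_mem_coeffSupported ?_ i))).1
    · exact fun n hn p hp => le_trans (by exact hn) (hp j)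
    · exact le_refl (m j)
  have hsM : s ∈ model e k V := by
    refine mem_model.2 ⟨hs, ?_⟩
    have : V.symm s = e (m, i) - V.symm w := by
      rw [V.symm_apply_eq, map_sub, V.apply_symm_apply, hx]; abel
    rw [this]
    refine sub_mem (basis_mem_coeffSupported hk i) (h.symm_map_mem ?_ hw')
    exact fun n hn p hp => lt_of_le_of_lt (hp k) hn
  rw [← inner_map_eq_symm, hx, inner_add_left]
  have h1 : ⟪w, f⟫_ℂ = 0 := by
    refine inner_eq_zero_of_disjoint ?_ hw hf.1
    exact disjoint_compl_left
  have h2 := hfo (Z.symm s) ⟨h.symm_map_model hjk hsM, h.shift_symm_mem ?_ hs2⟩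
  · rw [Z.apply_symm_apply] at h2
    rw [h1, h2, add_zero]
  · intro n hn
    simp only [Set.mem_setOf_eq, Pi.sub_apply, Pi.single_eq_same] at hn ⊢
    omega

/-- The vector `V w` is the projection of `e (m, i)` onto the model space: `w` is the part of `V* e
(m, i)` on `n_k < 0`, and `V s` is orthogonal to the model space. The support bound in direction `j`
serves the dual orthogonality lemma, the coefficients serve the trace. -/
lemma split_basis (h : ToeplitzUnitary e j Z V a) {m : Fin 2 → ℤ} (hm : 0 ≤ m k) (i : ι) :
    ∃ s ∈ coeffSupported e {n | 0 ≤ n k}, ∃ w ∈ coeffSupported e {n | n k < 0},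
      e (m, i) = V s + V w ∧ V w ∈ model e k V ∧
      w ∈ coeffSupported e {n | n j ≤ m j} ∧
      ∀ n l, n k < 0 → ⟪e (n, l), w⟫_ℂ = ⟪e (n, l), V.symm (e (m, i))⟫_ℂ := by
  obtain ⟨s, hs, w, hw, hx, -, hc⟩ := exists_split e {n | 0 ≤ n k} (V.symm (e (m, i)))
  have hx' : e (m, i) = V s + V w := by
    rw [← map_add, ← hx, V.apply_symm_apply]
  have hw2 := (split_mem hs hw hx (h.symm_map_mem (S := {n | n j ≤ m j})
    (fun n hn p hp => le_trans (hp j) (by exact hn))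
    (basis_mem_coeffSupported (le_refl (m j)) i))).2
  rw [compl_nonneg] at hw
  refine ⟨s, hs, w, hw, hx', mem_model.2 ⟨?_, ?_⟩, hw2, fun n l hn => hc n (not_le.2 hn) l⟩
  · have : V w = e (m, i) - V s := by rw [hx']; abel
    rw [this]
    refine sub_mem (basis_mem_coeffSupported hm i) (h.map_mem ?_ hs)
    exact fun n hn p hp => le_trans (by exact hn) (hp k)
  · rwa [V.symm_apply_apply]

lemma inner_map_model {s f : H} (hs : s ∈ coeffSupported e {n | 0 ≤ n k})
    (hf : f ∈ model e k V) : ⟪V s, f⟫_ℂ = 0 := by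
  rw [inner_map_eq_symm]
  refine inner_eq_zero_of_disjoint ?_ hs (mem_model.1 hf).2
  rw [← compl_nonneg]; exact disjoint_compl_right

/-- Dual to `mem_coanalytic_of_orthogonal`. For `m_j < 0 ≤ m_k` the projection `V w` of `e (m, i)`
has `w` supported in `n_j ≤ -1`, which leaves room for one shift: `Z (V w)` is still coanalytic. -/
lemma mem_analytic_of_orthogonal (h : ToeplitzUnitary e j Z V a) {f : H}
    (hf : f ∈ model e k V) (hjk : j ≠ k)
    (hfo : ∀ g ∈ model e k V ⊓ coanalytic e j V, ⟪Z.symm g, f⟫_ℂ = 0) :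
    f ∈ coeffSupported e {n | 0 ≤ n j} := by
  intro m hm i
  replace hm : m j < 0 := by simpa using hm
  by_cases hk : 0 ≤ m k
  swap
  · exact (mem_model.1 hf).1 m hk i
  obtain ⟨s, hs, w, hw, hx, hwM, hwj, -⟩ := h.split_basis hk i
  have h2 := hfo (Z (V w)) ⟨h.map_model hjk hwM, mem_coanalytic.2 ?_⟩
  · rw [Z.symm_apply_apply] at h2
    rw [hx, inner_add_left, inner_map_model hs hf, h2, add_zero]
  · rw [h.symm_comm, V.symm_apply_apply]
    refine h.shift_mem ?_ hwj
    intro n hn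
    simp only [Set.mem_setOf_eq, Pi.add_apply, Pi.single_eq_same] at hn ⊢
    omega

lemma wanderingData (h : ToeplitzUnitary e j Z V a) (hjk : j ≠ k) :
    WanderingData Z (model e k V) (coeffSupported e {n | 0 ≤ n j}) (coanalytic e j V) where
  closedM := isClosed_model e k V
  closedA := isClosed_coeffSupported _ _
  map_M := fun _ hf => h.map_model hjk hf
  symm_M := fun _ hf => h.symm_map_model hjk hf
  map_A := fun f hf => h.shift_mem (fun n hn => by
    simp only [Set.mem_setOf_eq, Pi.add_apply, Pi.single_eq_same] at hn ⊢; omega) hf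
  mem_B := fun f hf hfo => h.mem_coanalytic_of_orthogonal hf hjk hfo
  pureA := h.eq_zero_of_iterate_symm
  pureB := h.eq_zero_of_iterate

lemma wanderingData_symm (h : ToeplitzUnitary e j Z V a) (hjk : j ≠ k) :
    WanderingData Z.symm (model e k V) (coanalytic e j V) (coeffSupported e {n | 0 ≤ n j}) where
  closedM := isClosed_model e k V
  closedA := isClosed_map_equiv V _ (isClosed_coeffSupported _ _)
  map_M := fun _ hf => h.symm_map_model hjk hf
  symm_M := fun _ hf => h.map_model hjk hf
  map_A := fun f hf => by
    rw [mem_coanalytic] at hf ⊢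
    rw [h.symm_symm_comm]
    exact h.shift_symm_mem (fun n hn => by
      simp only [Set.mem_setOf_eq, Pi.sub_apply, Pi.single_eq_same] at hn ⊢; omega) hf
  mem_B := fun f hf hfo => h.mem_analytic_of_orthogonal hf hjk hfo
  pureA := h.eq_zero_of_iterate
  pureB := h.eq_zero_of_iterate_symm

lemma tsum_indicator_Ico (c : ℤ) (x : ℝ≥0∞) :
    ∑' b : ℤ, (if 0 ≤ b ∧ b < c then x else 0) = c.toNat * x := by
  rw [tsum_eq_sum (s := Finset.Ico 0 c) (fun b hb => if_neg (by simpa using hb)),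
    Finset.sum_congr rfl (g := fun _ => x) (fun b hb => if_pos (by simpa using hb))]
  simp

/-- The point of `ℤ²` with `j`-coordinate `c` and other coordinate `b`. -/
def pairIndex {α : Type*} (j : Fin 2) (c b : α) : Fin 2 → α := fun x => if x = j then c else b

/-- `pairIndex` as an equivalence. -/
def pairIndexEquiv (hjk : j ≠ k) (α ι : Type*) : α × (α × ι) ≃ (Fin 2 → α) × ι where
  toFun q := (pairIndex j q.1 q.2.1, q.2.2)
  invFun q := (q.1 j, q.1 k, q.2)
  left_inv q := by simp [pairIndex, hjk.symm]
  right_inv q := by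
    refine Prod.ext (funext fun x => ?_) rfl
    by_cases hx : x = j
    · simp [pairIndex, hx]
    · have : x = k := by omega
      simp [pairIndex, this, hjk.symm]

/-- For `b ≥ 0` the projection has the norm of the part of `V* e` on `n_k < 0`; with `q = m - n` the
entries are conjugates of `a q`, and `n_k < 0` becomes `b < q k`. For `b < 0` the basis vector is
orthogonal to the model space. -/
lemma enorm_sq_starProjection_basis (h : ToeplitzUnitary e j Z V a) (hjk : j ≠ k)
    [(model e k V).HasOrthogonalProjection] (b : ℤ) (i : ι) :
    ‖(model e k V).starProjection (e (pairIndex j 0 b, i))‖ₑ ^ 2 =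
      ∑' (q : Fin 2 → ℤ) (l : ι), if 0 ≤ b ∧ b < q k then ‖a q i l‖ₑ ^ 2 else 0 := by
  set m : Fin 2 → ℤ := pairIndex j 0 b with hm
  have hmk : m k = b := by simp [hm, pairIndex, hjk.symm]
  by_cases hb : 0 ≤ b
  · obtain ⟨s, hs, w, hw, hx, hwM, -, hc⟩ := h.split_basis (hmk.symm ▸ hb) i
    have h1 : (model e k V).starProjection (e (m, i)) = V w := by
      refine Submodule.eq_starProjection_of_mem_of_inner_eq_zero hwM fun f hf => ?_
      rw [hx, add_sub_cancel_right]
      exact inner_map_model hs hf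
    rw [h1, LinearIsometryEquiv.enorm_map, enorm_sq_eq_tsum e,
      ENNReal.tsum_prod (f := fun n l => ‖⟪e (n, l), w⟫_ℂ‖ₑ ^ 2),
      ← (Equiv.subLeft m).tsum_eq]
    refine tsum_congr fun q => tsum_congr fun l => ?_
    have h2 : (Equiv.subLeft m q) k = b - q k := by simp [hmk]
    by_cases hq : b < q k
    · rw [if_pos ⟨hb, hq⟩, hc _ _ (by rw [h2]; omega), h.inner_symm_eq, RCLike.enorm_conj]
      simp
    · rw [if_neg (by tauto), hw (Equiv.subLeft m q) (by simp only [Set.mem_setOf_eq, h2]; omega) l]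
      simp
  · have h1 : (model e k V).starProjection (e (m, i)) = 0 := by
      refine Submodule.eq_starProjection_of_mem_of_inner_eq_zero (zero_mem _) fun f hf => ?_
      rw [sub_zero]
      exact (mem_model.1 hf).1 m (by simpa [hmk] using hb) i
    rw [h1]
    simp [hb]

/-- After the sums are exchanged, the coefficient `a n` is counted once for each `b` with `0 ≤ b < n
k`, that is `(n k).toNat` times. -/
lemma trace_eq (h : ToeplitzUnitary e j Z V a) (hjk : j ≠ k)
    [(model e k V).HasOrthogonalProjection] :
    ∑' q : ℤ × ι, ‖(model e k V).starProjection (e (pairIndex j 0 q.1, q.2))‖ₑ ^ 2 =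
      ∑' n : Fin 2 → ℤ, (n k).toNat * ∑' (i : ι) (l : ι), ‖a n i l‖ₑ ^ 2 := by
  simp_rw [h.enorm_sq_starProjection_basis hjk]
  rw [ENNReal.tsum_prod (f := fun b i =>
    ∑' (q : Fin 2 → ℤ) (l : ι), if 0 ≤ b ∧ b < q k then ‖a q i l‖ₑ ^ 2 else 0)]
  calc _ = ∑' (b : ℤ) (q : Fin 2 → ℤ) (i : ι) (l : ι),
        (if 0 ≤ b ∧ b < q k then ‖a q i l‖ₑ ^ 2 else 0) :=
        tsum_congr fun b => ENNReal.tsum_comm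
    _ = ∑' (q : Fin 2 → ℤ) (b : ℤ) (i : ι) (l : ι),
        (if 0 ≤ b ∧ b < q k then ‖a q i l‖ₑ ^ 2 else 0) := ENNReal.tsum_comm
    _ = _ := by
      refine tsum_congr fun q => ?_
      rw [← ENNReal.tsum_mul_left, ENNReal.tsum_comm]
      refine tsum_congr fun i => ?_
      rw [← ENNReal.tsum_mul_left, ENNReal.tsum_comm]
      exact tsum_congr fun l => tsum_indicator_Ico _ _

/-- Both wandering subspaces have the dimension `∑ n_k ‖a n‖²`. -/
theorem rank_eq (h : ToeplitzUnitary e j Z V a) (hjk : j ≠ k) (d : ℕ)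
    (hd : ∑' n : Fin 2 → ℤ, (n k).toNat * ∑' (i : ι) (l : ι), ‖a n i l‖ₑ ^ 2 = (d : ℝ≥0∞)) :
    Module.rank ℂ (wandering Z (model e k V) (coeffSupported e {n | 0 ≤ n j})
      (coanalytic e j V)) = d ∧
    Module.rank ℂ (wandering Z.symm (model e k V) (coanalytic e j V)
      (coeffSupported e {n | 0 ≤ n j})) = d := by
  have : CompleteSpace (model e k V) := (isClosed_model e k V).completeSpace_coe
  have hpow : ∀ (c b : ℤ) (i : ι), e (pairIndex j c b, i) = (Z ^ c) (e (pairIndex j 0 b, i)) := by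
    have hs : ∀ (c b : ℤ), pairIndex j c b + Pi.single j 1 = pairIndex j (c + 1) b := by
      intro c b; funext x
      by_cases hx : x = j <;> simp [pairIndex, hx]
    intro c b i
    induction c using Int.induction_on with
    | zero => rw [WanderingData.zpow_zero_apply]
    | succ n ih =>
      rw [add_comm, WanderingData.zpow_add_apply, ← ih, zpow_one, h.shift_basis, hs, add_comm]
    | pred n ih =>
      rw [sub_eq_add_neg, add_comm, WanderingData.zpow_add_apply, ← ih, zpow_neg_one]
      have : Z⁻¹ (e (pairIndex j (-(n : ℤ)) b, i)) = Z.symm (e (pairIndex j (-(n : ℤ)) b, i)) := rfl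
      rw [this, Z.eq_symm_apply, h.shift_basis, hs]
      congr 3; ring
  let σ := pairIndexEquiv hjk ℤ ι
  have hsp : ∀ τ : ℤ × (ℤ × ι) ≃ (Fin 2 → ℤ) × ι,
      (Submodule.span ℂ (Set.range (e ∘ τ)))ᗮ = ⊥ := by
    intro τ
    rw [τ.surjective.range_comp, Submodule.eq_bot_iff]
    intro x hx
    exact eq_zero_of_coeff (e := e) fun n i => hx _ (Submodule.subset_span ⟨(n, i), rfl⟩)
  let ε := HilbertBasis.mkOfOrthogonalEqBot (e.orthonormal.comp σ σ.injective) (hsp σ)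
  -- For `Z.symm` the same basis is indexed with the opposite sign in direction `j`.
  let σ' := ((Equiv.neg ℤ).prodCongr (Equiv.refl (ℤ × ι))).trans σ
  let ε' := HilbertBasis.mkOfOrthogonalEqBot (e.orthonormal.comp σ' σ'.injective) (hsp σ')
  have hε : ∀ c b i, ε (c, (b, i)) = e (pairIndex j c b, i) := fun c b i => by
    simp [ε, σ, pairIndexEquiv]
  have hε' : ∀ c b i, ε' (c, (b, i)) = e (pairIndex j (-c) b, i) := fun c b i => by
    simp [ε', σ', σ, pairIndexEquiv]
  constructor
  · refine (h.wanderingData hjk).rank_wandering ε (fun c q => ?_) d ?_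
    · obtain ⟨b, i⟩ := q
      rw [hε, hε, hpow]
    · rw [← hd, ← h.trace_eq hjk]
      exact tsum_congr fun q => by obtain ⟨b, i⟩ := q; rw [hε]
  · refine (h.wanderingData_symm hjk).rank_wandering ε' (fun c q => ?_) d ?_
    · obtain ⟨b, i⟩ := q
      rw [hε', hε', hpow, neg_zero]
      have : (Z.symm : H ≃ₗᵢ[ℂ] H) = Z⁻¹ := rfl
      rw [this, inv_zpow']
    · rw [← hd, ← h.trace_eq hjk]
      exact tsum_congr fun q => by obtain ⟨b, i⟩ := q; rw [hε', neg_zero]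

end ToeplitzUnitary
end Bidisk
end

noncomputable section
namespace Bidisk

open scoped ENNReal InnerProductSpace

/-! ### The Fourier basis of vector-valued `L²` -/

section FourierBasis

/-- The Fourier basis of the scalar space `L²(𝕋²)`. -/
def scalarBasis : HilbertBasis (Fin 2 → ℤ) ℂ (Lp ℂ 2 torusMeasure) :=
  UnitAddTorus.mFourierBasis (d := Fin 2)

lemma scalarBasis_repr (f : Lp ℂ 2 torusMeasure) (n : Fin 2 → ℤ) :
    scalarBasis.repr f n = ∫ t, UnitAddTorus.mFourier (-n) t • f t ∂torusMeasure :=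
  UnitAddTorus.mFourierBasis_repr (d := Fin 2) f n

lemma integral_mFourier (n : Fin 2 → ℤ) :
    ∫ t, UnitAddTorus.mFourier n t ∂torusMeasure = if n = 0 then 1 else 0 := by
  have h := orthonormal_iff_ite.1 (UnitAddTorus.orthonormal_mFourier (d := Fin 2)) 0 n
  simp only [ContinuousMap.inner_toLp, ← UnitAddTorus.mFourier_neg,
    ← UnitAddTorus.mFourier_add, neg_zero, add_zero] at h
  simp only [eq_comm (a := n)]
  exact h

variable {N : ℕ}

lemma memLp_mFourier_single (n : Fin 2 → ℤ) (i : Fin N) :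
    MemLp (fun t => UnitAddTorus.mFourier n t • EuclideanSpace.single i (1 : ℂ)) 2
      torusMeasure := by
  refine MemLp.of_bound (by fun_prop) 1 (Eventually.of_forall fun t => ?_)
  rw [norm_smul, EuclideanSpace.norm_single, norm_one, mul_one]
  exact ((UnitAddTorus.mFourier n).norm_coe_le_norm t).trans UnitAddTorus.mFourier_norm.le

/-- The function `z^n e_i`. -/
def monomialVec (q : (Fin 2 → ℤ) × Fin N) : L2 N := (memLp_mFourier_single q.1 q.2).toLp _

lemma coeFn_monomialVec (n : Fin 2 → ℤ) (i : Fin N) :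
    ⇑(monomialVec (n, i)) =ᵐ[torusMeasure]
      fun t => UnitAddTorus.mFourier n t • EuclideanSpace.single i (1 : ℂ) :=
  MemLp.coeFn_toLp _

lemma inner_monomialVec (n : Fin 2 → ℤ) (i : Fin N) (f : L2 N) :
    ⟪monomialVec (n, i), f⟫_ℂ = ∫ t, UnitAddTorus.mFourier (-n) t * f t i ∂torusMeasure := by
  rw [L2.inner_def]
  refine integral_congr_ae ?_
  filter_upwards [coeFn_monomialVec n i] with t ht
  rw [ht, inner_smul_left, EuclideanSpace.inner_single_left, map_one, one_mul,
    UnitAddTorus.mFourier_neg]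

lemma inner_monomialVec_eq_coeff (n : Fin 2 → ℤ) (i : Fin N) (f : L2 N) :
    ⟪monomialVec (n, i), f⟫_ℂ = UnitAddTorus.mFourierCoeff f n i := by
  rw [inner_monomialVec, mFourierCoeff_eq]
  exact (EuclideanSpace.proj (𝕜 := ℂ) i).integral_comp_comm (integrable_mFourier_smul f (-n))

lemma orthonormal_monomialVec : Orthonormal ℂ (monomialVec (N := N)) := by
  rw [orthonormal_iff_ite]
  rintro ⟨m, i⟩ ⟨n, l⟩
  rw [inner_monomialVec]
  have : ∀ᵐ t ∂torusMeasure, UnitAddTorus.mFourier (-m) t * monomialVec (n, l) t i =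
      UnitAddTorus.mFourier (-m + n) t * (if i = l then 1 else 0) := by
    filter_upwards [coeFn_monomialVec n l] with t ht
    rw [ht, UnitAddTorus.mFourier_add, PiLp.smul_apply, EuclideanSpace.single_apply, smul_eq_mul,
      mul_assoc]
  rw [integral_congr_ae this, integral_mul_const, integral_mFourier]
  by_cases h1 : m = n <;> by_cases h2 : i = l <;> simp [h1, h2, neg_add_eq_zero]

lemma eq_zero_of_inner_monomialVec (f : L2 N) (h : ∀ n i, ⟪monomialVec (n, i), f⟫_ℂ = 0) :
    f = 0 := by
  have h1 : ∀ i, (EuclideanSpace.proj i : EuclideanSpace ℂ (Fin N) →L[ℂ] ℂ).compLp f = 0 := by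
    intro i
    refine scalarBasis.repr.map_eq_zero_iff.1 ?_
    ext n
    rw [scalarBasis_repr]
    refine Eq.trans ?_ (h n i)
    rw [inner_monomialVec]
    refine integral_congr_ae ?_
    filter_upwards [ContinuousLinearMap.coeFn_compLp
      (EuclideanSpace.proj i : EuclideanSpace ℂ (Fin N) →L[ℂ] ℂ) f] with t ht
    rw [ht]; rfl
  refine Lp.ext ?_
  have h2 : ∀ᵐ t ∂torusMeasure, ∀ i, f t i = 0 := by
    rw [ae_all_iff]
    intro i
    have h3 := ContinuousLinearMap.coeFn_compLp
      (EuclideanSpace.proj i : EuclideanSpace ℂ (Fin N) →L[ℂ] ℂ) f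
    rw [h1 i] at h3
    filter_upwards [h3, Lp.coeFn_zero ℂ 2 torusMeasure] with t ht ht0
    rw [ht0] at ht
    exact ht.symm
  filter_upwards [h2, Lp.coeFn_zero (EuclideanSpace ℂ (Fin N)) 2 torusMeasure] with t ht ht0
  rw [ht0]
  ext i
  exact ht i

/-- The Fourier basis of `L²(𝕋²) ⊗ ℂᴺ`. -/
def fourierBasis (N : ℕ) : HilbertBasis ((Fin 2 → ℤ) × Fin N) ℂ (L2 N) :=
  HilbertBasis.mkOfOrthogonalEqBot orthonormal_monomialVec <| by
    rw [Submodule.eq_bot_iff]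
    intro x hx
    exact eq_zero_of_inner_monomialVec x fun n i => hx _ (Submodule.subset_span ⟨(n, i), rfl⟩)

lemma fourierBasis_apply (q : (Fin 2 → ℤ) × Fin N) : fourierBasis N q = monomialVec q := by
  simp [fourierBasis]

lemma coeffSupported_fourierBasis (S : Set (Fin 2 → ℤ)) :
    coeffSupported (fourierBasis N) S = fourierSupported N S := by
  ext f
  change (∀ n ∉ S, ∀ i, _ = _) ↔ ∀ n, n ∉ S → _ = _
  refine forall₂_congr fun n _ => ?_
  simp_rw [fourierBasis_apply, inner_monomialVec_eq_coeff]
  constructor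
  · intro h; ext i; exact h i
  · intro h i; rw [h]; rfl

end FourierBasis

/-! ### Multiplication by unitary matrix functions -/

section Multiplication

variable {N : ℕ}

/-- Measurable matrix functions on the torus with unitary values almost everywhere. -/
structure UnitaryAE (G : UnitAddTorus (Fin 2) → Matrix (Fin N) (Fin N) ℂ) : Prop where
  meas : ∀ i l, AEStronglyMeasurable (fun t => G t i l) torusMeasure
  unitary : ∀ᵐ t ∂torusMeasure, G t ∈ Matrix.unitaryGroup (Fin N) ℂ

variable {G : UnitAddTorus (Fin 2) → Matrix (Fin N) (Fin N) ℂ}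

lemma UnitaryAE.conjTranspose (hG : UnitaryAE G) : UnitaryAE fun t => (G t).conjTranspose where
  meas i l := RCLike.continuous_conj.comp_aestronglyMeasurable (hG.meas l i)
  unitary := hG.unitary.mono fun t ht => Unitary.star_mem ht

lemma norm_toEuclideanLin_of_unitary {A : Matrix (Fin N) (Fin N) ℂ}
    (hA : A ∈ Matrix.unitaryGroup (Fin N) ℂ) (v : EuclideanSpace ℂ (Fin N)) :
    ‖Matrix.toEuclideanLin A v‖ = ‖v‖ := by
  have h : ⟪Matrix.toEuclideanLin A v, Matrix.toEuclideanLin A v⟫_ℂ = ⟪v, v⟫_ℂ := by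
    rw [← LinearMap.adjoint_inner_left, ← Matrix.toEuclideanLin_conjTranspose_eq_adjoint]
    congr 1
    rw [Matrix.toEuclideanLin_apply, Matrix.toEuclideanLin_apply, WithLp.ofLp_toLp,
      Matrix.mulVec_mulVec]
    have : A.conjTranspose * A = 1 := Matrix.mem_unitaryGroup_iff'.1 hA
    rw [this, Matrix.one_mulVec]
  rw [inner_self_eq_norm_sq_to_K, inner_self_eq_norm_sq_to_K] at h
  have h' : ‖Matrix.toEuclideanLin A v‖ ^ 2 = ‖v‖ ^ 2 := by exact_mod_cast h
  exact (pow_left_inj₀ (norm_nonneg _) (norm_nonneg _) two_ne_zero).1 h'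

lemma UnitaryAE.aestronglyMeasurable (hG : UnitaryAE G) (f : L2 N) :
    AEStronglyMeasurable (fun t => Matrix.toEuclideanLin (G t) (f t)) torusMeasure := by
  have h : AEMeasurable (fun t i => ∑ l, G t i l * f t l) torusMeasure := by
    refine aemeasurable_pi_lambda _ fun i => ?_
    refine Finset.aemeasurable_fun_sum _ fun l _ => ?_
    refine (hG.meas i l).aemeasurable.mul ?_
    exact ((EuclideanSpace.proj l : EuclideanSpace ℂ (Fin N) →L[ℂ] ℂ).continuous.comp_aestronglyMeasurable
      (Lp.aestronglyMeasurable f)).aemeasurable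
  exact (PiLp.continuous_toLp 2 _).comp_aestronglyMeasurable h.aestronglyMeasurable

lemma UnitaryAE.memLp (hG : UnitaryAE G) (f : L2 N) :
    MemLp (fun t => Matrix.toEuclideanLin (G t) (f t)) 2 torusMeasure := by
  refine (Lp.memLp f).of_le
    (hG.aestronglyMeasurable f) ?_
  filter_upwards [hG.unitary] with t ht
  exact (norm_toEuclideanLin_of_unitary ht _).le

/-- Multiplication by `G`. -/
def UnitaryAE.mul (hG : UnitaryAE G) (f : L2 N) : L2 N := (hG.memLp f).toLp _

lemma UnitaryAE.coeFn_mul (hG : UnitaryAE G) (f : L2 N) :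
    ⇑(hG.mul f) =ᵐ[torusMeasure] fun t => Matrix.toEuclideanLin (G t) (f t) :=
  MemLp.coeFn_toLp _

/-- Multiplication by a unitary matrix function as a unitary operator. -/
def UnitaryAE.equiv (hG : UnitaryAE G) : L2 N ≃ₗᵢ[ℂ] L2 N where
  toFun := hG.mul
  invFun := hG.conjTranspose.mul
  map_add' f g := by
    refine Lp.ext ?_
    filter_upwards [hG.coeFn_mul f, hG.coeFn_mul g, hG.coeFn_mul (f + g), Lp.coeFn_add f g,
      Lp.coeFn_add (hG.mul f) (hG.mul g)] with t h1 h2 h3 h4 h5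
    rw [h3, h5, h4, Pi.add_apply, Pi.add_apply, map_add, h1, h2]
  map_smul' c f := by
    refine Lp.ext ?_
    filter_upwards [hG.coeFn_mul f, hG.coeFn_mul (c • f), Lp.coeFn_smul c f,
      Lp.coeFn_smul c (hG.mul f)] with t h1 h3 h4 h5
    rw [h3, RingHom.id_apply, h5, h4, Pi.smul_apply, Pi.smul_apply, map_smul, h1]
  left_inv f := by
    refine Lp.ext ?_
    filter_upwards [hG.coeFn_mul f, hG.conjTranspose.coeFn_mul (hG.mul f), hG.unitary]
      with t h1 h2 h3
    rw [h2, h1, Matrix.toEuclideanLin_apply, Matrix.toEuclideanLin_apply, WithLp.ofLp_toLp,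
      Matrix.mulVec_mulVec, ← Matrix.star_eq_conjTranspose,
      Matrix.mem_unitaryGroup_iff'.1 h3, Matrix.one_mulVec]
  right_inv f := by
    refine Lp.ext ?_
    filter_upwards [hG.conjTranspose.coeFn_mul f, hG.coeFn_mul (hG.conjTranspose.mul f),
      hG.unitary] with t h1 h2 h3
    rw [h2, h1, Matrix.toEuclideanLin_apply, Matrix.toEuclideanLin_apply, WithLp.ofLp_toLp,
      Matrix.mulVec_mulVec, ← Matrix.star_eq_conjTranspose,
      Matrix.mem_unitaryGroup_iff.1 h3, Matrix.one_mulVec]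
  norm_map' f := by
    change ‖hG.mul f‖ = ‖f‖
    rw [Lp.norm_def, Lp.norm_def]
    congr 1
    refine eLpNorm_congr_norm_ae ?_
    filter_upwards [hG.coeFn_mul f, hG.unitary] with t h1 h2
    rw [h1, norm_toEuclideanLin_of_unitary h2]

lemma UnitaryAE.coeFn_equiv (hG : UnitaryAE G) (f : L2 N) :
    ⇑(hG.equiv f) =ᵐ[torusMeasure] fun t => Matrix.toEuclideanLin (G t) (f t) :=
  hG.coeFn_mul f

lemma UnitaryAE.mem_mulImage (hG : UnitaryAE G) (S : Submodule ℂ (L2 N)) (f : L2 N) :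
    f ∈ mulImage G S ↔ hG.equiv.symm f ∈ S := by
  constructor
  · rintro ⟨h, hh, hf⟩
    have : f = hG.equiv h := by
      refine Lp.ext ?_
      filter_upwards [hf, hG.coeFn_equiv h] with t h1 h2
      rw [h1, h2]
    rwa [this, LinearIsometryEquiv.symm_apply_apply]
  · intro h
    refine ⟨_, h, ?_⟩
    have := hG.coeFn_equiv (hG.equiv.symm f)
    rwa [LinearIsometryEquiv.apply_symm_apply] at this

lemma continuous_torusPoint (j : Fin 2) : Continuous fun t => torusPoint t j :=
  continuous_subtype_val.comp (AddCircle.continuous_toCircle.comp (continuous_apply j))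

lemma unitaryAE_coordinate (N : ℕ) (j : Fin 2) :
    UnitaryAE fun t => Matrix.scalar (Fin N) (torusPoint t j) where
  meas i l := by
    by_cases h : i = l
    · subst h
      simpa using (continuous_torusPoint j).aestronglyMeasurable
    · simpa [h] using aestronglyMeasurable_const
  unitary := Eventually.of_forall fun t => by
    rw [Matrix.mem_unitaryGroup_iff, Matrix.star_eq_conjTranspose, Matrix.scalar_apply,
      Matrix.diagonal_conjTranspose, Matrix.diagonal_mul_diagonal, ← Matrix.diagonal_one]
    congr 1
    funext i
    have : ‖torusPoint t j‖ = 1 := Circle.norm_coe _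
    rw [Pi.star_apply, RCLike.star_def, Complex.mul_conj, Complex.normSq_eq_norm_sq, this]
    simp

lemma mFourier_add_single (n : Fin 2 → ℤ) (j : Fin 2) (t : UnitAddTorus (Fin 2)) :
    UnitAddTorus.mFourier (n + Pi.single j 1) t =
      torusPoint t j * UnitAddTorus.mFourier n t := by
  rw [UnitAddTorus.mFourier_add, UnitAddTorus.mFourier_single, fourier_one, mul_comm]
  rfl

lemma toeplitzUnitary (hG : UnitaryAE G) (j : Fin 2)
    (ha : ∀ n : Fin 2 → ℤ, (∃ x, n x < 0) → ∀ l i,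
      UnitAddTorus.mFourierCoeff (fun t => G t l i) n = 0) :
    ToeplitzUnitary (fourierBasis N) j (unitaryAE_coordinate N j).equiv hG.equiv
      (fun n l i => UnitAddTorus.mFourierCoeff (fun t => G t l i) n) where
  shift_basis n i := by
    rw [fourierBasis_apply, fourierBasis_apply]
    refine Lp.ext ?_
    filter_upwards [(unitaryAE_coordinate N j).coeFn_equiv (monomialVec (n, i)),
      coeFn_monomialVec n i, coeFn_monomialVec (n + Pi.single j 1) i] with t h1 h2 h3
    rw [h1, h2, h3, mFourier_add_single, mul_smul, Matrix.toEuclideanLin_apply]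
    ext l
    simp [Matrix.scalar_apply, Matrix.mulVec_diagonal, Pi.single_apply]
  comm f := by
    refine Lp.ext ?_
    filter_upwards [(unitaryAE_coordinate N j).coeFn_equiv f, hG.coeFn_equiv f,
      (unitaryAE_coordinate N j).coeFn_equiv (hG.equiv f),
      hG.coeFn_equiv ((unitaryAE_coordinate N j).equiv f)] with t h1 h2 h3 h4
    rw [h3, h4, h1, h2]
    simp only [Matrix.toEuclideanLin_apply, Matrix.mulVec_mulVec]
    rw [(Matrix.scalar_commute _ (fun r => Commute.all _ r) (G t)).eq]
  inner_eq m n l i := by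
    rw [fourierBasis_apply, fourierBasis_apply, inner_monomialVec]
    change _ = ∫ t, UnitAddTorus.mFourier (-(m - n)) t • G t l i ∂torusMeasure
    refine integral_congr_ae ?_
    filter_upwards [hG.coeFn_equiv (monomialVec (n, i)), coeFn_monomialVec n i] with t h1 h2
    rw [h1, h2, map_smul, neg_sub, sub_eq_add_neg, UnitAddTorus.mFourier_add,
      Matrix.toEuclideanLin_apply]
    simp
    ring
  analytic := ha

end Multiplication

/-! ### The spaces of the theorem as wandering subspaces -/

section Spaces

variable {N : ℕ}

lemma mem_coeffSupported_inter {H ι : Type*} [NormedAddCommGroup H] [InnerProductSpace ℂ H]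
    (e : HilbertBasis ((Fin 2 → ℤ) × ι) ℂ H) (S T : Set (Fin 2 → ℤ)) (x : H) :
    x ∈ coeffSupported e (S ∩ T) ↔ x ∈ coeffSupported e S ∧ x ∈ coeffSupported e T := by
  constructor
  · intro h
    exact ⟨fun n hn => h n fun h' => hn h'.1, fun n hn => h n fun h' => hn h'.2⟩
  · rintro ⟨h1, h2⟩ n hn
    by_cases hS : n ∈ S
    · exact h2 n fun hT => hn ⟨hS, hT⟩
    · exact h1 n hS

lemma setOf_forall_eq_inter {j k : Fin 2} (hjk : j ≠ k) (P : ℤ → Prop) :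
    {n : Fin 2 → ℤ | ∀ x, P (n x)} = {n | P (n j)} ∩ {n | P (n k)} := by
  ext n
  refine ⟨fun h => ⟨h j, h k⟩, fun h x => ?_⟩
  by_cases hx : x = j
  · exact hx ▸ h.1
  · have : x = k := by omega
    exact this ▸ h.2

lemma mem_K {φ : (Fin 2 → ℂ) → Matrix (Fin N) (Fin N) ℂ} (hG : UnitaryAE (boundaryValue φ))
    {j k : Fin 2} (hjk : j ≠ k) (x : L2 N) :
    x ∈ K φ ↔ (x ∈ coeffSupported (fourierBasis N) {n | 0 ≤ n j} ∧
      x ∈ coeffSupported (fourierBasis N) {n | 0 ≤ n k}) ∧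
      hG.equiv.symm x ∈ coeffSupported (fourierBasis N) {n | n j < 0} ∧
      hG.equiv.symm x ∈ coeffSupported (fourierBasis N) {n | n k < 0} := by
  rw [K, Submodule.mem_inf, hG.mem_mulImage, hardy, L2negNeg, ← coeffSupported_fourierBasis,
    ← coeffSupported_fourierBasis, setOf_forall_eq_inter hjk (fun c => 0 ≤ c),
    setOf_forall_eq_inter hjk (fun c => c < 0), mem_coeffSupported_inter, mem_coeffSupported_inter]

namespace ToeplitzUnitary

variable {H ι : Type*} [NormedAddCommGroup H] [InnerProductSpace ℂ H] [CompleteSpace H]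
  {e : HilbertBasis ((Fin 2 → ℤ) × ι) ℂ H} {j k : Fin 2} {Z V : H ≃ₗᵢ[ℂ] H}
  {a : (Fin 2 → ℤ) → ι → ι → ℂ}

lemma shift_symm_mem_iff (h : ToeplitzUnitary e j Z V a) {S T : Set (Fin 2 → ℤ)}
    (hST : ∀ n, n ∈ S ↔ n + Pi.single j 1 ∈ T) (x : H) :
    Z.symm x ∈ coeffSupported e S ↔ x ∈ coeffSupported e T := by
  constructor
  · intro hx
    rw [← Z.apply_symm_apply x]
    exact h.shift_mem (fun n hn => (hST n).1 hn) hx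
  · exact h.shift_symm_mem fun n hn => by rw [hST, sub_add_cancel]; exact hn

lemma shift_symm_mem_other (h : ToeplitzUnitary e j Z V a) (hjk : j ≠ k) (P : ℤ → Prop) (x : H) :
    Z.symm x ∈ coeffSupported e {n | P (n k)} ↔ x ∈ coeffSupported e {n | P (n k)} :=
  h.shift_symm_mem_iff (fun n => by simp [hjk.symm]) x

lemma shift_symm_mem_neg (h : ToeplitzUnitary e j Z V a) (x : H) :
    Z.symm x ∈ coeffSupported e {n | n j < 0} ↔ x ∈ coeffSupported e {n | n j ≤ 0} :=
  h.shift_symm_mem_iff (fun n => by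
    simp only [Set.mem_setOf_eq, Pi.add_apply, Pi.single_eq_same]; omega) x

end ToeplitzUnitary

/-- The dimensions in terms of the Fourier coefficients of the boundary values. -/
theorem rank_of_fourierCoeff (φ : (Fin 2 → ℂ) → Matrix (Fin N) (Fin N) ℂ)
    (hG : UnitaryAE (boundaryValue φ))
    (ha : ∀ n : Fin 2 → ℤ, (∃ x, n x < 0) → ∀ l i,
      UnitAddTorus.mFourierCoeff (fun t => boundaryValue φ t l i) n = 0)
    {j k : Fin 2} (hjk : j ≠ k) (d : ℕ)
    (hd : ∑' n : Fin 2 → ℤ, (n k).toNat * ∑' (l : Fin N) (i : Fin N),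
      ‖UnitAddTorus.mFourierCoeff (fun t => boundaryValue φ t l i) n‖ₑ ^ 2 = (d : ℝ≥0∞)) :
    Module.rank ℂ (ominus (Ksup j φ) (shift j (K φ))) = d ∧
    Module.rank ℂ (ominus (Ksup j φ) (K φ)) = d := by
  have h := toeplitzUnitary hG j ha
  set e := fourierBasis N
  set V := hG.equiv
  set Z := (unitaryAE_coordinate N j).equiv
  have hmK := mem_K hG hjk
  have hshift : ∀ (S : Submodule ℂ (L2 N)) x, x ∈ shift j S ↔ Z.symm x ∈ S := fun S x =>
    (unitaryAE_coordinate N j).mem_mulImage S x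
  have hKsup : ∀ x, x ∈ Ksup j φ ↔ (x ∈ coeffSupported e {n | 0 ≤ n j} ∧
      x ∈ coeffSupported e {n | 0 ≤ n k}) ∧
      V.symm x ∈ coeffSupported e {n | n j ≤ 0} ∧
      V.symm x ∈ coeffSupported e {n | n k < 0} := by
    intro x
    rw [Ksup, Submodule.mem_inf, hshift, hG.mem_mulImage, hardy, L2negNeg,
      ← coeffSupported_fourierBasis, ← coeffSupported_fourierBasis,
      setOf_forall_eq_inter hjk (fun c => 0 ≤ c), setOf_forall_eq_inter hjk (fun c => c < 0),
      mem_coeffSupported_inter, mem_coeffSupported_inter, h.symm_symm_comm,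
      h.shift_symm_mem_neg, h.shift_symm_mem_other hjk (fun c => c < 0)]
  have hM : ∀ x, x ∈ ToeplitzUnitary.model e k V ↔ _ := fun x => ToeplitzUnitary.mem_model
  have hB : ∀ x, x ∈ ToeplitzUnitary.coanalytic e j V ↔ _ := fun x => ToeplitzUnitary.mem_coanalytic
  -- Here `Z K = Z (M ∩ A) ∩ B`: the condition `n_j < 0` on `V* Z⁻¹ x` is `n_j ≤ 0` on `V* x`.
  have h1 : ominus (Ksup j φ) (shift j (K φ)) = wandering Z (ToeplitzUnitary.model e k V)
      (coeffSupported e {n | 0 ≤ n j}) (ToeplitzUnitary.coanalytic e j V) := by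
    rw [ominus, wandering]
    congr 2
    · ext x
      rw [hKsup, Submodule.mem_inf, Submodule.mem_inf, hM, hB]
      tauto
    · ext x
      rw [hshift, hmK, Submodule.mem_inf, ToeplitzUnitary.mem_map_equiv, Submodule.mem_inf, hM, hB,
        h.symm_symm_comm, h.shift_symm_mem_neg]
      tauto
  -- Here `K = Z⁻¹ (M ∩ B) ∩ A`, so the roles of `A` and `B` are exchanged and `Z` is replaced by
  -- its inverse.
  have h2 : ominus (Ksup j φ) (K φ) = wandering Z.symm (ToeplitzUnitary.model e k V)
      (ToeplitzUnitary.coanalytic e j V) (coeffSupported e {n | 0 ≤ n j}) := by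
    rw [ominus, wandering]
    congr 2
    · ext x
      rw [hKsup, Submodule.mem_inf, Submodule.mem_inf, hM, hB]
      tauto
    · ext x
      have h3 := h.shift_symm_mem_neg (Z (V.symm x))
      have h4 := h.shift_symm_mem_other hjk (fun c => 0 ≤ c) (Z x)
      have h5 := h.shift_symm_mem_other hjk (fun c => c < 0) (Z (V.symm x))
      rw [Z.symm_apply_apply] at h3 h4 h5
      rw [hmK, Submodule.mem_inf, ToeplitzUnitary.mem_map_equiv, LinearIsometryEquiv.symm_symm,
        Submodule.mem_inf, hM, hB, h.symm_comm]
      tauto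
  rw [h1, h2]
  exact h.rank_eq hjk d hd

end Spaces
end Bidisk
end

noncomputable section
namespace Bidisk

open scoped ENNReal InnerProductSpace ComplexConjugate
open Polynomial AddCircle

/-! ### Fourier coefficients and the Dirichlet integral on the circle -/

section CircleIntegrals

/-- The coordinate function on the circle. -/
def circlePoint (t : UnitAddCircle) : ℂ := (toCircle t : ℂ)

lemma norm_circlePoint (t : UnitAddCircle) : ‖circlePoint t‖ = 1 := Circle.norm_coe _

lemma circlePoint_ne_zero (t : UnitAddCircle) : circlePoint t ≠ 0 := Circle.coe_ne_zero _

lemma continuous_circlePoint : Continuous circlePoint :=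
  continuous_subtype_val.comp continuous_toCircle

lemma fourier_eq_circlePoint_zpow (n : ℤ) (t : UnitAddCircle) :
    fourier n t = circlePoint t ^ n := by
  rw [fourier_apply, toCircle_zsmul, circlePoint, Circle.coe_zpow]

lemma integral_circle_eq (G : ℂ → ℂ) :
    ∫ t : UnitAddCircle, G (circlePoint t) ∂haarAddCircle =
      (2 * Real.pi * Complex.I)⁻¹ * ∮ z in C(0, 1), z⁻¹ * G z := by
  have h1 := fourierCoeff_eq_intervalIntegral (T := 1) (fun t => G (circlePoint t)) 0 0
  have h2 := Real.circleAverage_eq_circleIntegral (F := ℂ) (f := G) (c := 0) (R := 1) one_ne_zero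
  rw [fourierCoeff] at h1
  simp only [neg_zero, fourier_zero, one_smul, zero_add, div_one] at h1
  rw [h1]
  simp only [sub_zero, smul_eq_mul] at h2
  rw [← h2, Real.circleAverage_def]
  have h3 := intervalIntegral.integral_comp_mul_left (fun θ => G (circleMap 0 1 θ))
    (c := 2 * Real.pi) (a := 0) (b := 1) (by positivity)
  rw [mul_zero, mul_one] at h3
  rw [← h3]
  refine intervalIntegral.integral_congr fun x _ => ?_
  simp [circlePoint, toCircle_apply_mk, Circle.coe_exp, circleMap]

lemma two_pi_I_ne_zero : (2 * Real.pi * Complex.I : ℂ) ≠ 0 := Complex.two_pi_I_ne_zero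

lemma integral_circle_eq_mul (G : ℂ → ℂ) :
    ∫ t : UnitAddCircle, circlePoint t * G (circlePoint t) ∂haarAddCircle =
      (2 * Real.pi * Complex.I)⁻¹ * ∮ z in C(0, 1), G z := by
  rw [integral_circle_eq fun z => z * G z]
  congr 1
  refine circleIntegral.integral_congr zero_le_one fun z hz => ?_
  have : z ≠ 0 := by rintro rfl; simp at hz
  simp [this]

/-- Negative Fourier coefficients of an analytic function vanish. -/
lemma fourierCoeff_eq_zero_of_neg {G : ℂ → ℂ} (hG : ∀ z, ‖z‖ ≤ 1 → DifferentiableAt ℂ G z)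
    {n : ℤ} (hn : n < 0) : fourierCoeff (fun t : UnitAddCircle => G (circlePoint t)) n = 0 := by
  obtain ⟨m, hm⟩ := Int.eq_ofNat_of_zero_le (show 0 ≤ -n - 1 by omega)
  have h1 : ∀ t : UnitAddCircle, fourier (-n) t • G (circlePoint t) =
      circlePoint t * (fun z => z ^ m * G z) (circlePoint t) := by
    intro t
    rw [fourier_eq_circlePoint_zpow, show -n = ((m + 1 : ℕ) : ℤ) by push_cast; omega,
      zpow_natCast, pow_succ', smul_eq_mul, mul_assoc]
  rw [fourierCoeff]
  simp_rw [h1]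
  have hd : ∀ z, ‖z‖ ≤ 1 → DifferentiableAt ℂ (fun z => z ^ m * G z) z := fun z hz =>
    (differentiableAt_id.pow m).mul (hG z hz)
  rw [integral_circle_eq_mul (fun z => z ^ m * G z),
    Complex.circleIntegral_eq_zero_of_differentiable_on_off_countable zero_le_one
      Set.countable_empty, mul_zero]
  · exact fun z hz => (hd z (by simpa using hz)).continuousAt.continuousWithinAt
  · exact fun z hz => hd z (mem_ball_zero_iff.1 hz.1).le

/-- Integration by parts for Fourier coefficients on the circle. -/
lemma fourierCoeff_mul_deriv {G G' : ℂ → ℂ} (hG : ∀ z, ‖z‖ = 1 → HasDerivAt G (G' z) z)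
    (hG' : Continuous fun t : UnitAddCircle => G' (circlePoint t)) (n : ℤ) :
    fourierCoeff (fun t : UnitAddCircle => circlePoint t * G' (circlePoint t)) n =
      n * fourierCoeff (fun t : UnitAddCircle => G (circlePoint t)) n := by
  have hGc : Continuous fun t : UnitAddCircle => G (circlePoint t) := by
    refine continuous_iff_continuousAt.2 fun t => ?_
    exact (hG _ (norm_circlePoint t)).continuousAt.comp continuous_circlePoint.continuousAt
  -- The integrand is the derivative of `z ^ (-n) * G z`, so its integral over the closed curve
  -- vanishes.
  have h0 : ∮ z in C(0, 1), ((-n : ℤ) * z ^ (-n - 1) * G z + z ^ (-n) * G' z) = 0 := by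
    refine circleIntegral.integral_eq_zero_of_hasDerivWithinAt (f := fun z => z ^ (-n) * G z)
      zero_le_one fun z hz => ?_
    have hz1 : ‖z‖ = 1 := by simpa using hz
    have hz0 : z ≠ 0 := by rintro rfl; simp at hz1
    exact ((hasDerivAt_zpow (-n) z (Or.inl hz0)).mul (hG z hz1)).hasDerivWithinAt
  have h1 := integral_circle_eq_mul (fun z => (-n : ℤ) * z ^ (-n - 1) * G z + z ^ (-n) * G' z)
  rw [h0, mul_zero] at h1
  have h2 : ∀ t : UnitAddCircle, circlePoint t * ((-n : ℤ) * circlePoint t ^ (-n - 1) *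
      G (circlePoint t) + circlePoint t ^ (-n) * G' (circlePoint t)) =
      fourier (-n) t • (circlePoint t * G' (circlePoint t)) -
        n * (fourier (-n) t • G (circlePoint t)) := by
    intro t
    rw [fourier_eq_circlePoint_zpow, zpow_sub_one₀ (circlePoint_ne_zero t), smul_eq_mul,
      smul_eq_mul]
    have := circlePoint_ne_zero t
    push_cast
    field_simp
    ring
  simp_rw [h2] at h1
  have hi : ∀ f : UnitAddCircle → ℂ, Continuous f → Integrable f haarAddCircle := fun f hf =>
    hf.integrable_of_hasCompactSupport (HasCompactSupport.of_compactSpace f)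
  rw [integral_sub, integral_const_mul, sub_eq_zero] at h1
  · exact h1
  · exact hi _ ((fourier (-n)).continuous.smul (continuous_circlePoint.mul hG'))
  · exact (hi _ ((fourier (-n)).continuous.smul hGc)).const_mul _

lemma hasSum_conj_mul_fourierCoeff (f g : C(UnitAddCircle, ℂ)) :
    HasSum (fun n => conj (fourierCoeff f n) * fourierCoeff g n)
      (∫ t, conj (f t) * g t ∂haarAddCircle) := by
  have h := (_root_.fourierBasis (T := (1 : ℝ))).hasSum_inner_mul_inner
    (ContinuousMap.toLp 2 haarAddCircle ℂ f) (ContinuousMap.toLp 2 haarAddCircle ℂ g)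
  rw [ContinuousMap.inner_toLp] at h
  simp only [mul_comm (g _)] at h
  refine h.congr_fun fun n => ?_
  rw [← inner_conj_symm, ← HilbertBasis.repr_apply_apply, ← HilbertBasis.repr_apply_apply,
    fourierBasis_repr, fourierBasis_repr, fourierCoeff_toLp, fourierCoeff_toLp]

/-- The Dirichlet integral on the circle as a sum over Fourier coefficients. -/
lemma hasSum_mul_norm_fourierCoeff {G G' : ℂ → ℂ}
    (hG : ∀ z, ‖z‖ = 1 → HasDerivAt G (G' z) z)
    (hG' : Continuous fun t : UnitAddCircle => G' (circlePoint t)) :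
    HasSum (fun n : ℤ =>
        ((n * ‖fourierCoeff (fun t : UnitAddCircle => G (circlePoint t)) n‖ ^ 2 : ℝ) : ℂ))
      (∫ t : UnitAddCircle, conj (G (circlePoint t)) * (circlePoint t * G' (circlePoint t))
        ∂haarAddCircle) := by
  have hGc : Continuous fun t : UnitAddCircle => G (circlePoint t) := by
    refine continuous_iff_continuousAt.2 fun t => ?_
    exact (hG _ (norm_circlePoint t)).continuousAt.comp continuous_circlePoint.continuousAt
  have h := hasSum_conj_mul_fourierCoeff ⟨_, hGc⟩ ⟨_, continuous_circlePoint.mul hG'⟩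
  refine h.congr_fun fun n => ?_
  change _ = conj (fourierCoeff (fun t : UnitAddCircle => G (circlePoint t)) n) *
    fourierCoeff (fun t : UnitAddCircle => circlePoint t * G' (circlePoint t)) n
  rw [fourierCoeff_mul_deriv hG hG', mul_left_comm, ← Complex.normSq_eq_conj_mul_self,
    Complex.normSq_eq_norm_sq]
  push_cast
  rfl

end CircleIntegrals

/-! ### The argument principle for polynomials -/

section ArgumentPrinciple

lemma sub_ne_zero_of_norm {r : ℂ} (hr : ‖r‖ ≠ 1) (t : UnitAddCircle) : circlePoint t - r ≠ 0 := by
  intro h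
  rw [sub_eq_zero] at h
  exact hr (h ▸ norm_circlePoint t)

lemma integral_circlePoint_div_sub {r : ℂ} (hr : ‖r‖ ≠ 1) :
    ∫ t : UnitAddCircle, circlePoint t * (1 / (circlePoint t - r)) ∂haarAddCircle =
      if ‖r‖ < 1 then 1 else 0 := by
  rw [integral_circle_eq_mul (fun z => 1 / (z - r))]
  simp only [one_div]
  split_ifs with h
  · rw [circleIntegral.integral_sub_inv_of_mem_ball (by simpa using h),
      inv_mul_cancel₀ two_pi_I_ne_zero]
  · have h1 : ∀ z, ‖z‖ ≤ 1 → DifferentiableAt ℂ (fun z => (z - r)⁻¹) z := fun z hz =>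
      (differentiableAt_id.sub_const r).inv (by
        intro h0
        rw [id, sub_eq_zero] at h0
        subst h0
        exact h (lt_of_le_of_ne hz hr))
    rw [Complex.circleIntegral_eq_zero_of_differentiable_on_off_countable zero_le_one
      Set.countable_empty, mul_zero]
    · exact fun z hz => (h1 z (by simpa using hz)).continuousAt.continuousWithinAt
    · exact fun z hz => h1 z (mem_ball_zero_iff.1 hz.1).le

lemma integral_circlePoint_sum (s : Multiset ℂ) (hs : ∀ r ∈ s, ‖r‖ ≠ 1) :
    Continuous (fun t : UnitAddCircle =>
      circlePoint t * (s.map fun r => 1 / (circlePoint t - r)).sum) ∧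
    ∫ t : UnitAddCircle, circlePoint t * (s.map fun r => 1 / (circlePoint t - r)).sum
      ∂haarAddCircle = (s.filter fun r => ‖r‖ < 1).card := by
  induction s using Multiset.induction_on with
  | empty => simp [continuous_const]
  | cons r s ih =>
    obtain ⟨h1, h2⟩ := ih fun x hx => hs x (Multiset.mem_cons_of_mem hx)
    have hr := hs r (Multiset.mem_cons_self r s)
    have h3 : Continuous fun t : UnitAddCircle => circlePoint t * (1 / (circlePoint t - r)) :=
      continuous_circlePoint.mul (continuous_const.div
        (continuous_circlePoint.sub continuous_const) (sub_ne_zero_of_norm hr))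
    have hi : ∀ f : UnitAddCircle → ℂ, Continuous f → Integrable f haarAddCircle := fun f hf =>
      hf.integrable_of_hasCompactSupport (HasCompactSupport.of_compactSpace f)
    simp only [Multiset.map_cons, Multiset.sum_cons, mul_add]
    refine ⟨h3.add h1, ?_⟩
    rw [integral_add (hi _ h3) (hi _ h1), h2, integral_circlePoint_div_sub hr,
      Multiset.filter_cons, Multiset.card_add]
    split_ifs <;> simp

/-- The argument principle for polynomials on the unit circle. -/
lemma integral_log_deriv (q : ℂ[X]) (hq : ∀ z : ℂ, ‖z‖ = 1 → q.eval z ≠ 0) :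
    Continuous (fun t : UnitAddCircle =>
      circlePoint t * (q.derivative.eval (circlePoint t) / q.eval (circlePoint t))) ∧
    ∫ t : UnitAddCircle,
      circlePoint t * (q.derivative.eval (circlePoint t) / q.eval (circlePoint t))
      ∂haarAddCircle = (q.roots.filter fun r => ‖r‖ < 1).card := by
  have h := integral_circlePoint_sum q.roots fun r hr h1 =>
    hq r h1 ((mem_roots'.1 hr).2)
  have h2 : ∀ t : UnitAddCircle, q.derivative.eval (circlePoint t) / q.eval (circlePoint t) =
      (q.roots.map fun r => 1 / (circlePoint t - r)).sum := fun t =>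
    (IsAlgClosed.splits q).eval_derivative_div_eval_of_ne_zero (hq _ (norm_circlePoint t))
  simp_rw [h2]
  exact h

end ArgumentPrinciple

/-! ### The derivative of a determinant -/

section DetDeriv

/-- Jacobi's formula. -/
lemma hasDerivAt_det {n : Type*} [Fintype n] [DecidableEq n] {F : ℂ → Matrix n n ℂ}
    {F' : Matrix n n ℂ} {z : ℂ} (hF : ∀ i j, HasDerivAt (fun w => F w i j) (F' i j) z) :
    HasDerivAt (fun w => (F w).det) ((F z).adjugate * F').trace z := by
  have h1 : HasDerivAt (fun w => (F w).det) (∑ σ : Equiv.Perm n, Equiv.Perm.sign σ •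
      ∑ i, (∏ j ∈ Finset.univ.erase i, F z (σ j) j) • F' (σ i) i) z := by
    simp only [Matrix.det_apply]
    refine HasDerivAt.fun_sum fun σ _ => ?_
    refine HasDerivAt.const_smul _ ?_
    exact HasDerivAt.fun_finset_prod fun i _ => hF (σ i) i
  convert! h1 using 1
  have h2 : ((F z).adjugate * F').trace = ∑ i, ((F z).updateCol i (fun l => F' l i)).det := by
    rw [Matrix.trace]
    refine Finset.sum_congr rfl fun i _ => ?_
    rw [Matrix.diag_apply, ← Matrix.cramer_apply, Matrix.cramer_eq_adjugate_mulVec]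
    rfl
  rw [h2]
  simp only [Matrix.det_apply, Finset.smul_sum]
  rw [Finset.sum_comm]
  refine Finset.sum_congr rfl fun σ _ => Finset.sum_congr rfl fun i _ => ?_
  congr 1
  rw [← Finset.mul_prod_erase _ _ (Finset.mem_univ i), Matrix.updateCol_self, mul_comm, smul_eq_mul]
  congr 1
  refine Finset.prod_congr rfl fun j hj => ?_
  rw [Matrix.updateCol_ne (Finset.ne_of_mem_erase hj)]

end DetDeriv

/-! ### Rational inner functions of one variable -/

section Slices

lemma infinite_unit_circle : {z : ℂ | ‖z‖ = 1}.Infinite := by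
  have h : Set.range (fun z : Circle => (z : ℂ)) ⊆ {z : ℂ | ‖z‖ = 1} := by
    rintro _ ⟨z, rfl⟩; exact Circle.norm_coe z
  have : Infinite (Set.Ioc (-Real.pi) Real.pi) :=
    (Set.Ioc_infinite (by linarith [Real.pi_pos])).to_subtype
  have : Infinite Circle := Infinite.of_injective _ Circle.argEquiv.symm.injective
  exact Set.Infinite.mono h (Set.infinite_range_of_injective Circle.coe_injective)

lemma eval_reflect (D : ℕ) (p : ℂ[X]) (hp : p.natDegree ≤ D) {z : ℂ} (hz : z ≠ 0) :
    (reflect D p).eval z = z ^ D * p.eval z⁻¹ := by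
  letI : Invertible z⁻¹ := invertibleOfNonzero (inv_ne_zero hz)
  have h := eval₂_reflect_mul_pow (RingHom.id ℂ) z⁻¹ D p hp
  rw [invOf_eq_inv, inv_inv] at h
  rw [← eval₂_id, ← eval₂_id, ← h, mul_comm, mul_assoc, ← mul_pow, inv_mul_cancel₀ hz, one_pow,
    mul_one]

lemma eval_map_conj (p : ℂ[X]) (z : ℂ) :
    (p.map (starRingEnd ℂ)).eval z = conj (p.eval (conj z)) := by
  have h := eval₂_at_apply (p := p) (starRingEnd ℂ) (conj z)
  rwa [Complex.conj_conj, ← eval_map] at h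

/-- If `a / c` is unimodular on the circle and `c` has no zeros in the disk, then all zeros of `a`
lie in the open disk and `c` has no zeros on the closed disk. -/
lemma roots_of_unimodular {a c : ℂ[X]} (hco : IsCoprime a c)
    (hc : ∀ z : ℂ, ‖z‖ < 1 → c.eval z ≠ 0)
    (hac : ∀ z : ℂ, ‖z‖ = 1 → ‖a.eval z‖ = ‖c.eval z‖) :
    (∀ z : ℂ, ‖z‖ ≤ 1 → c.eval z ≠ 0) ∧ ∀ z, a.eval z = 0 → ‖z‖ < 1 := by
  obtain ⟨u, v, huv⟩ := hco
  have hne : ∀ z, a.eval z = 0 → c.eval z ≠ 0 := by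
    intro z h1 h2
    have := congrArg (Polynomial.eval z) huv
    simp [h1, h2] at this
  have hne' : ∀ z : ℂ, ‖z‖ = 1 → a.eval z ≠ 0 := by
    intro z hz h
    refine hne z h ?_
    rw [← norm_eq_zero, ← hac z hz, h, norm_zero]
  refine ⟨fun z hz => ?_, fun z hz => ?_⟩
  · rcases hz.lt_or_eq with h | h
    · exact hc z h
    · intro h0
      refine hne' z h ?_
      rw [← norm_eq_zero, hac z h, h0, norm_zero]
  · by_contra! hcon
    rcases hcon.eq_or_lt with h | h
    · exact hne' z h.symm hz
    set D := max a.natDegree c.natDegree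
    have hda : (a.map (starRingEnd ℂ)).natDegree ≤ D :=
      natDegree_map_le.trans (le_max_left _ _)
    have hdc : (c.map (starRingEnd ℂ)).natDegree ≤ D :=
      natDegree_map_le.trans (le_max_right _ _)
    -- Schwarz reflection: on the circle `‖a‖² = ‖c‖²` is this polynomial identity, so it holds
    -- everywhere. At a zero `z` of `a` with `‖z‖ > 1` the left side vanishes, while `c z ≠ 0` by
    -- coprimality and the reflected factor is nonzero because `1 / conj z` is in the open disk.
    have hid : a * reflect D (a.map (starRingEnd ℂ)) = c * reflect D (c.map (starRingEnd ℂ)) := by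
      refine eq_of_infinite_eval_eq _ _ (infinite_unit_circle.mono fun w hw => ?_)
      have hw1 : ‖w‖ = 1 := hw
      have hw0 : w ≠ 0 := by rintro rfl; simp at hw1
      have hinv : conj w⁻¹ = w := by
        rw [map_inv₀, Complex.inv_def, Complex.conj_conj, Complex.normSq_conj,
          Complex.normSq_eq_norm_sq, hw1]
        simp
      have h2 : ∀ p : ℂ[X], p.eval w * (w ^ D * conj (p.eval w)) = w ^ D * (‖p.eval w‖ : ℂ) ^ 2 := by
        intro p
        rw [← Complex.mul_conj']; ring
      simp only [Set.mem_setOf_eq, eval_mul]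
      rw [eval_reflect D _ hda hw0, eval_reflect D _ hdc hw0, eval_map_conj, eval_map_conj, hinv,
        h2, h2, hac w hw1]
    have hz0 : z ≠ 0 := by rintro rfl; simp at h; linarith
    have h3 := congrArg (Polynomial.eval z) hid
    rw [eval_mul, eval_mul, hz, zero_mul, eval_reflect D _ hdc hz0, eval_map_conj] at h3
    have h4 := hne z hz
    have h5 : c.eval (conj z⁻¹) ≠ 0 := by
      refine hc _ ?_
      rw [RCLike.norm_conj, norm_inv]
      exact inv_lt_one_of_one_lt₀ h
    have : conj (c.eval (conj z⁻¹)) ≠ 0 := by simpa using h5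
    exact mul_ne_zero h4 (mul_ne_zero (pow_ne_zero D hz0) this) h3.symm

variable {N : ℕ}

/-- A rational matrix function of one variable, evaluated at a point. -/
def ratEval (A : Matrix (Fin N) (Fin N) ℂ[X]) (b : ℂ[X]) (z : ℂ) : Matrix (Fin N) (Fin N) ℂ :=
  (b.eval z)⁻¹ • A.map (Polynomial.eval z)

lemma ratEval_apply (A : Matrix (Fin N) (Fin N) ℂ[X]) (b : ℂ[X]) (z : ℂ) (i l : Fin N) :
    ratEval A b z i l = (b.eval z)⁻¹ * (A i l).eval z := rfl

lemma det_ratEval (A : Matrix (Fin N) (Fin N) ℂ[X]) (b : ℂ[X]) (z : ℂ) :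
    (ratEval A b z).det = (b.eval z)⁻¹ ^ N * A.det.eval z := by
  rw [ratEval, Matrix.det_smul, Fintype.card_fin]
  congr 1
  exact ((Polynomial.evalRingHom z).map_det A).symm

lemma det_ratEval_eq_div {A : Matrix (Fin N) (Fin N) ℂ[X]} {b a c : ℂ[X]}
    (hdet : A.det * c = b ^ N * a) {z : ℂ} (hb : b.eval z ≠ 0) (hc : c.eval z ≠ 0) :
    (ratEval A b z).det = a.eval z / c.eval z := by
  have h := congrArg (Polynomial.eval z) hdet
  rw [eval_mul, eval_mul, eval_pow] at h
  rw [det_ratEval, eq_div_iff hc, mul_assoc, h, ← mul_assoc, ← mul_pow, inv_mul_cancel₀ hb,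
    one_pow, one_mul]

lemma trace_conjTranspose_mul {n : Type*} [Fintype n] (X Y : Matrix n n ℂ) :
    (X.conjTranspose * Y).trace = ∑ i, ∑ l, conj (X i l) * Y i l := by
  simp only [Matrix.trace, Matrix.diag_apply, Matrix.mul_apply, Matrix.conjTranspose_apply]
  rw [Finset.sum_comm]
  rfl

/-- Logarithmic derivative of the determinant of a rational function unitary at `z`. -/
lemma sum_conj_mul_deriv {A : Matrix (Fin N) (Fin N) ℂ[X]} {b a c : ℂ[X]}
    (hdet : A.det * c = b ^ N * a) {z : ℂ} (hb : b.eval z ≠ 0) (hc : c.eval z ≠ 0)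
    (ha : a.eval z ≠ 0) (hU : ratEval A b z ∈ Matrix.unitaryGroup (Fin N) ℂ)
    {F' : Matrix (Fin N) (Fin N) ℂ}
    (hF : ∀ i l, HasDerivAt (fun w => ratEval A b w i l) (F' i l) z) :
    ∑ i, ∑ l, conj (ratEval A b z i l) * F' i l =
      a.derivative.eval z / a.eval z - c.derivative.eval z / c.eval z := by
  have h1 := hasDerivAt_det hF
  have h2 : HasDerivAt (fun w => (ratEval A b w).det)
      ((a.derivative.eval z * c.eval z - a.eval z * c.derivative.eval z) / c.eval z ^ 2) z := by
    refine ((a.hasDerivAt z).fun_div (c.hasDerivAt z) hc).congr_of_eventuallyEq ?_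
    filter_upwards [b.continuous.continuousAt.eventually_ne hb,
      c.continuous.continuousAt.eventually_ne hc] with w hw1 hw2
    exact det_ratEval_eq_div hdet hw1 hw2
  have h3 := h1.unique h2
  have hdz := det_ratEval_eq_div hdet hb hc
  -- For a unitary matrix the adjugate is the determinant times the adjoint, so Jacobi's formula
  -- gives the logarithmic derivative of the determinant as `tr (F* F')`.
  have hadj : (ratEval A b z).adjugate = (a.eval z / c.eval z) • (ratEval A b z).conjTranspose := by
    have hX : ratEval A b z * (ratEval A b z).conjTranspose = 1 := Matrix.mem_unitaryGroup_iff.1 hU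
    calc (ratEval A b z).adjugate = (ratEval A b z).adjugate *
          (ratEval A b z * (ratEval A b z).conjTranspose) := by rw [hX, mul_one]
      _ = _ := by rw [← mul_assoc, Matrix.adjugate_mul, hdz, Matrix.smul_mul, one_mul]
  rw [hadj, Matrix.smul_mul, Matrix.trace_smul, trace_conjTranspose_mul, smul_eq_mul] at h3
  have h4 : a.eval z / c.eval z ≠ 0 := div_ne_zero ha hc
  refine mul_left_cancel₀ h4 (h3.trans ?_)
  field_simp

/-- The coefficient identity for rational inner functions of one variable. -/
theorem tsum_fourierCoeff_ratEval {A : Matrix (Fin N) (Fin N) ℂ[X]} {b a c : ℂ[X]}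
    (hb : ∀ z : ℂ, ‖z‖ ≤ 1 → b.eval z ≠ 0)
    (hU : ∀ z : ℂ, ‖z‖ = 1 → ratEval A b z ∈ Matrix.unitaryGroup (Fin N) ℂ)
    (hdet : A.det * c = b ^ N * a) (hco : IsCoprime a c)
    (hc : ∀ z : ℂ, ‖z‖ < 1 → c.eval z ≠ 0) :
    (∀ n < 0, ∀ i l,
      fourierCoeff (fun t : UnitAddCircle => ratEval A b (circlePoint t) i l) n = 0) ∧
    ∑' n : ℤ, (n.toNat : ℝ≥0∞) * ∑ i, ∑ l,
      ‖fourierCoeff (fun t : UnitAddCircle => ratEval A b (circlePoint t) i l) n‖ₑ ^ 2 =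
      a.natDegree := by
  have hneg : ∀ n < 0, ∀ i l,
      fourierCoeff (fun t : UnitAddCircle => ratEval A b (circlePoint t) i l) n = 0 := by
    intro n hn i l
    refine fourierCoeff_eq_zero_of_neg (G := fun z => ratEval A b z i l) (fun z hz => ?_) hn
    exact (b.differentiableAt.inv (hb z hz)).mul (A i l).differentiableAt
  refine ⟨hneg, ?_⟩
  have hac : ∀ z : ℂ, ‖z‖ = 1 → ‖a.eval z‖ = ‖c.eval z‖ := by
    intro z hz
    have h1 := Matrix.det_of_mem_unitary (hU z hz)
    have h2 : ‖(ratEval A b z).det‖ = 1 := CStarRing.norm_of_mem_unitary h1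
    have h := congrArg (Polynomial.eval z) hdet
    rw [eval_mul, eval_mul, eval_pow] at h
    rw [det_ratEval, norm_mul, norm_pow, norm_inv] at h2
    have h3 := congrArg norm h
    rw [norm_mul, norm_mul, norm_pow] at h3
    have h4 : ‖b.eval z‖ ≠ 0 := norm_ne_zero_iff.2 (hb z hz.le)
    have h5 : ‖A.det.eval z‖ = ‖b.eval z‖ ^ N := by
      rw [inv_pow] at h2
      field_simp at h2
      exact h2
    rw [h5] at h3
    exact (mul_left_cancel₀ (pow_ne_zero N h4) h3).symm
  obtain ⟨hc', ha'⟩ := roots_of_unimodular hco hc hac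
  have ha1 : ∀ z : ℂ, ‖z‖ = 1 → a.eval z ≠ 0 := fun z hz h => (ha' z h).ne hz
  have hc1 : ∀ z : ℂ, ‖z‖ = 1 → c.eval z ≠ 0 := fun z hz => hc' z hz.le
  let F' : ℂ → Matrix (Fin N) (Fin N) ℂ := fun z => Matrix.of fun i l =>
    -b.derivative.eval z / b.eval z ^ 2 * (A i l).eval z +
      (b.eval z)⁻¹ * (A i l).derivative.eval z
  have hF : ∀ z : ℂ, ‖z‖ = 1 → ∀ i l, HasDerivAt (fun w => ratEval A b w i l) (F' z i l) z :=
    fun z hz i l => ((b.hasDerivAt z).fun_inv (hb z hz.le)).mul ((A i l).hasDerivAt z)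
  have hp : ∀ p : ℂ[X], Continuous fun t : UnitAddCircle => p.eval (circlePoint t) := fun p =>
    p.continuous.comp continuous_circlePoint
  have hb0 : ∀ t : UnitAddCircle, b.eval (circlePoint t) ≠ 0 := fun t =>
    hb _ (norm_circlePoint t).le
  have hF'c : ∀ i l, Continuous fun t : UnitAddCircle => F' (circlePoint t) i l := fun i l =>
    (((hp _).neg.div ((hp b).pow 2) fun t => pow_ne_zero 2 (hb0 t)).mul (hp _)).add
      (((hp b).inv₀ hb0).mul (hp _))
  have hFc : ∀ i l, Continuous fun t : UnitAddCircle => ratEval A b (circlePoint t) i l :=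
    fun i l => ((hp b).inv₀ hb0).mul (hp _)
  have hi : ∀ f : UnitAddCircle → ℂ, Continuous f → Integrable f haarAddCircle := fun f hf =>
    hf.integrable_of_hasCompactSupport (HasCompactSupport.of_compactSpace f)
  have hsum := hasSum_sum (s := Finset.univ) fun i _ => hasSum_sum (s := Finset.univ)
    fun l _ => hasSum_mul_norm_fourierCoeff (G := fun z => ratEval A b z i l)
      (G' := fun z => F' z i l) (fun z hz => hF z hz i l) (hF'c i l)
  -- The integrand is the difference of the logarithmic derivatives of `a` and `c`; all roots of `a`
  -- and none of `c` are in the open disk.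
  have hint : (∑ i, ∑ l, ∫ t : UnitAddCircle, conj (ratEval A b (circlePoint t) i l) *
      (circlePoint t * F' (circlePoint t) i l) ∂haarAddCircle) = (a.natDegree : ℂ) := by
    have hcon : ∀ i l, Integrable (fun t : UnitAddCircle => conj (ratEval A b (circlePoint t) i l) *
      (circlePoint t * F' (circlePoint t) i l)) haarAddCircle := fun i l =>
        hi _ ((RCLike.continuous_conj.comp (hFc i l)).mul
          (continuous_circlePoint.mul (hF'c i l)))
    simp_rw [← integral_finsetSum Finset.univ fun l _ => hcon _ l]
    rw [← integral_finsetSum Finset.univ fun i _ => integrable_finsetSum _ fun l _ => hcon i l]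
    have h1 : ∀ t : UnitAddCircle, (∑ i, ∑ l, conj (ratEval A b (circlePoint t) i l) *
        (circlePoint t * F' (circlePoint t) i l)) =
        circlePoint t * (a.derivative.eval (circlePoint t) / a.eval (circlePoint t)) -
        circlePoint t * (c.derivative.eval (circlePoint t) / c.eval (circlePoint t)) := by
      intro t
      have ht := norm_circlePoint t
      rw [← mul_sub, ← sum_conj_mul_deriv hdet (hb0 t) (hc1 _ ht) (ha1 _ ht) (hU _ ht) (hF _ ht),
        Finset.mul_sum]
      refine Finset.sum_congr rfl fun i _ => ?_
      rw [Finset.mul_sum]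
      exact Finset.sum_congr rfl fun l _ => by ring
    simp_rw [h1]
    obtain ⟨ca, ia⟩ := integral_log_deriv a ha1
    obtain ⟨cc, ic⟩ := integral_log_deriv c hc1
    rw [integral_sub (hi _ ca) (hi _ cc), ia, ic, Multiset.filter_eq_self.2,
      Multiset.filter_eq_nil.2, (IsAlgClosed.splits a).natDegree_eq_card_roots]
    · simp
    · exact fun r hr h => hc r h (mem_roots'.1 hr).2
    · exact fun r hr => ha' r (mem_roots'.1 hr).2
  rw [hint] at hsum
  have hre : HasSum (fun n : ℤ => ∑ i, ∑ l, (n : ℝ) *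
      ‖fourierCoeff (fun t : UnitAddCircle => ratEval A b (circlePoint t) i l) n‖ ^ 2)
      (a.natDegree : ℝ) := by
    have := Complex.hasSum_re hsum
    simpa only [Complex.re_sum, Complex.ofReal_re, Complex.natCast_re] using this
  -- Replacing `n` by `n.toNat` is harmless because the coefficients of negative index vanish.
  have hterm : ∀ n : ℤ, (∑ i, ∑ l, (n : ℝ) *
      ‖fourierCoeff (fun t : UnitAddCircle => ratEval A b (circlePoint t) i l) n‖ ^ 2) =
      n.toNat * ∑ i, ∑ l,
      ‖fourierCoeff (fun t : UnitAddCircle => ratEval A b (circlePoint t) i l) n‖ ^ 2 := by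
    intro n
    rcases lt_or_ge n 0 with hn | hn
    · simp [hneg n hn]
    · have h : (n : ℝ) = (n.toNat : ℝ) := by
        exact_mod_cast congrArg (Int.cast (R := ℝ)) (Int.toNat_of_nonneg hn).symm
      simp_rw [h, Finset.mul_sum]
  simp_rw [hterm] at hre
  have h4 := ENNReal.ofReal_tsum_of_nonneg (fun n => by positivity) hre.summable
  rw [hre.tsum_eq, ENNReal.ofReal_natCast] at h4
  rw [h4]
  refine tsum_congr fun n => ?_
  rw [ENNReal.ofReal_mul (by positivity), ENNReal.ofReal_natCast,
    ENNReal.ofReal_sum_of_nonneg fun i _ => by positivity]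
  congr 1
  refine Finset.sum_congr rfl fun i _ => ?_
  rw [ENNReal.ofReal_sum_of_nonneg fun l _ => by positivity]
  refine Finset.sum_congr rfl fun l _ => ?_
  rw [ENNReal.ofReal_pow (norm_nonneg _), ofReal_norm]

end Slices
end Bidisk
end

noncomputable section
namespace Bidisk

open scoped ENNReal
open Polynomial AddCircle

/-! ### Slices of polynomials in two variables -/

section TwoVariables

/-- Polynomials in two variables as polynomials in `z_k` over polynomials in the other variable. -/
def biPoly (k : Fin 2) : MvPolynomial (Fin 2) ℂ ≃ₐ[ℂ] ℂ[X][X] :=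
  ((MvPolynomial.renameEquiv ℂ (Equiv.swap 0 k)).trans (MvPolynomial.finSuccEquiv ℂ 1)).trans
    (Polynomial.mapAlgEquiv (MvPolynomial.uniqueAlgEquiv ℂ (Fin 1)))

lemma natDegree_biPoly (k : Fin 2) (p : MvPolynomial (Fin 2) ℂ) :
    (biPoly k p).natDegree = MvPolynomial.degreeOf k p := by
  have h1 : (biPoly k p).natDegree = (MvPolynomial.finSuccEquiv ℂ 1
      (MvPolynomial.rename (Equiv.swap 0 k) p)).natDegree :=
    natDegree_map_eq_of_injective (MvPolynomial.uniqueAlgEquiv ℂ (Fin 1)).injective _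
  rw [h1, MvPolynomial.natDegree_finSuccEquiv]
  have h2 := MvPolynomial.degreeOf_rename_of_injective (p := p) (Equiv.swap 0 k).injective k
  rwa [Equiv.swap_apply_right] at h2

/-- The polynomial in `z_k` obtained by fixing the other variable to be `x`. -/
def slicePoly (k : Fin 2) (x : ℂ) : MvPolynomial (Fin 2) ℂ →+* ℂ[X] :=
  (mapRingHom (evalRingHom x)).comp (biPoly k : MvPolynomial (Fin 2) ℂ →+* ℂ[X][X])

lemma slicePoly_apply (k : Fin 2) (x : ℂ) (p : MvPolynomial (Fin 2) ℂ) :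
    slicePoly k x p = (biPoly k p).map (evalRingHom x) := rfl

lemma finSuccEquiv_X_one : MvPolynomial.finSuccEquiv ℂ 1 (MvPolynomial.X 1) =
    C (MvPolynomial.X 0) :=
  MvPolynomial.finSuccEquiv_X_succ (j := (0 : Fin 1))

open ToeplitzUnitary in
lemma eval_slicePoly {j k : Fin 2} (hjk : j ≠ k) (x y : ℂ) (p : MvPolynomial (Fin 2) ℂ) :
    (slicePoly k x p).eval y = MvPolynomial.eval (pairIndex j x y) p := by
  have h : (evalRingHom y).comp (slicePoly k x) = MvPolynomial.eval (pairIndex j x y) := by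
    refine MvPolynomial.ringHom_ext (fun r => ?_) fun i => ?_
    · simp [slicePoly_apply, biPoly, MvPolynomial.finSuccEquiv_apply]
    · rcases (show (j = 0 ∧ k = 1) ∨ (j = 1 ∧ k = 0) by omega) with ⟨rfl, rfl⟩ | ⟨rfl, rfl⟩ <;> fin_cases i
      · simp [slicePoly_apply, biPoly, finSuccEquiv_X_one, pairIndex]
      · simp [slicePoly_apply, biPoly, MvPolynomial.finSuccEquiv_X_zero, pairIndex]
      · simp [slicePoly_apply, biPoly, MvPolynomial.finSuccEquiv_X_zero, pairIndex]
      · simp [slicePoly_apply, biPoly, finSuccEquiv_X_one, pairIndex]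
  exact DFunLike.congr_fun h p

lemma natDegree_slicePoly (k : Fin 2) {x : ℂ} (p : MvPolynomial (Fin 2) ℂ)
    (hx : (biPoly k p).leadingCoeff.eval x ≠ 0) :
    (slicePoly k x p).natDegree = MvPolynomial.degreeOf k p := by
  rw [slicePoly_apply, natDegree_map_of_leadingCoeff_ne_zero _ hx, natDegree_biPoly]

lemma slicePoly_ne_zero (k : Fin 2) {x : ℂ} (p : MvPolynomial (Fin 2) ℂ)
    (hx : (biPoly k p).leadingCoeff.eval x ≠ 0) : slicePoly k x p ≠ 0 := by
  intro h
  have h1 := congrArg (fun q => q.coeff (biPoly k p).natDegree) h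
  simp only [slicePoly_apply, coeff_map, coe_evalRingHom, coeff_zero] at h1
  exact hx h1

/-- Every root lies outside the open disk, hence at distance at least `1 - ‖α‖` from `α`. The bound
involves only the leading coefficient and the degree, so it survives a limit of polynomials of
constant degree; it takes the place of Hurwitz's theorem below. -/
lemma norm_eval_ge (q : ℂ[X]) (hq : ∀ z : ℂ, ‖z‖ < 1 → q.eval z ≠ 0) {α : ℂ} (hα : ‖α‖ < 1) :
    ‖q.leadingCoeff‖ * (1 - ‖α‖) ^ q.natDegree ≤ ‖q.eval α‖ := by
  have h0 : q ≠ 0 := by rintro rfl; exact hq 0 (by simp) (by simp)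
  have hs := IsAlgClosed.splits q
  rw [hs.eval_eq_prod_roots, norm_mul, hs.natDegree_eq_card_roots]
  refine mul_le_mul_of_nonneg_left ?_ (norm_nonneg _)
  have h1 : ∀ r ∈ q.roots, 1 - ‖α‖ ≤ ‖α - r‖ := by
    intro r hr
    have h2 : 1 ≤ ‖r‖ := by
      by_contra! h
      exact hq r h (mem_roots'.1 hr).2
    have h3 := norm_sub_norm_le r α
    rw [norm_sub_rev] at h3
    linarith
  generalize q.roots = s at h1
  induction s using Multiset.induction_on with
  | empty => simp
  | cons r s ih =>
    rw [Multiset.map_cons, Multiset.prod_cons, Multiset.card_cons, pow_succ', norm_mul]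
    refine mul_le_mul (h1 r (Multiset.mem_cons_self r s))
      (ih fun x hx => h1 x (Multiset.mem_cons_of_mem hx)) ?_ (norm_nonneg _)
    exact pow_nonneg (by linarith) _

open ToeplitzUnitary in
lemma pairIndex_mem_bidisk {j : Fin 2} {x y : ℂ} (hx : ‖x‖ < 1) (hy : ‖y‖ < 1) :
    pairIndex j x y ∈ bidisk := by
  intro i
  by_cases h : i = j <;> simp [pairIndex, h, hx, hy]

open ToeplitzUnitary in
/-- Slices at boundary points of polynomials without zeros in the bidisk. -/
lemma eval_slicePoly_ne_zero {j k : Fin 2} (hjk : j ≠ k) (p : MvPolynomial (Fin 2) ℂ)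
    (hp : ∀ z ∈ bidisk, MvPolynomial.eval z p ≠ 0) {x : ℂ} (hx : ‖x‖ = 1)
    (hlc : (biPoly k p).leadingCoeff.eval x ≠ 0) {y : ℂ} (hy : ‖y‖ < 1) :
    (slicePoly k x p).eval y ≠ 0 := by
  set d := (biPoly k p).natDegree
  set L := (biPoly k p).leadingCoeff
  have hrx : Tendsto (fun r : ℝ => (r : ℂ) * x) (𝓝[<] 1) (𝓝 x) := by
    have : Continuous fun r : ℝ => (r : ℂ) * x := by fun_prop
    have h := this.tendsto 1
    rw [Complex.ofReal_one, one_mul] at h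
    exact h.mono_left nhdsWithin_le_nhds
  have h1 : Tendsto (fun r : ℝ => ‖L.eval ((r : ℂ) * x)‖ * (1 - ‖y‖) ^ d) (𝓝[<] 1)
      (𝓝 (‖L.eval x‖ * (1 - ‖y‖) ^ d)) :=
    (((L.continuous.tendsto x).comp hrx).norm).mul_const _
  have h2 : Tendsto (fun r : ℝ => ‖(slicePoly k ((r : ℂ) * x) p).eval y‖) (𝓝[<] 1)
      (𝓝 ‖(slicePoly k x p).eval y‖) := by
    simp_rw [eval_slicePoly hjk]
    have hc : Continuous fun w : ℂ => MvPolynomial.eval (pairIndex j w y) p := by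
      refine (MvPolynomial.continuous_eval p).comp (continuous_pi fun i => ?_)
      by_cases h : i = j
      · simpa [pairIndex, h] using continuous_id'
      · simpa [pairIndex, h] using continuous_const
    exact ((hc.tendsto x).comp hrx).norm
  -- For `r < 1` near `1` the slice at `r x` has no zeros in the disk and has full degree, so the
  -- lower bound applies; then `r → 1`.
  have h3 : ∀ᶠ r : ℝ in 𝓝[<] 1, ‖L.eval ((r : ℂ) * x)‖ * (1 - ‖y‖) ^ d ≤
      ‖(slicePoly k ((r : ℂ) * x) p).eval y‖ := by
    filter_upwards [((L.continuous.tendsto x).comp hrx).eventually_ne hlc, self_mem_nhdsWithin,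
      mem_nhdsWithin_of_mem_nhds (Ioi_mem_nhds (show (0 : ℝ) < 1 by norm_num))] with r hr hr1 hr0
    have hn : ‖(r : ℂ) * x‖ < 1 := by
      rw [norm_mul, hx, mul_one, Complex.norm_real, Real.norm_of_nonneg (le_of_lt hr0)]
      exact hr1
    have h4 := norm_eval_ge (slicePoly k ((r : ℂ) * x) p) (fun z hz => by
      rw [eval_slicePoly hjk]
      exact hp _ (pairIndex_mem_bidisk hn hz)) hy
    have h5 : (slicePoly k ((r : ℂ) * x) p).natDegree = d := by
      rw [slicePoly_apply, natDegree_map_of_leadingCoeff_ne_zero _ hr]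
    have h6 : (slicePoly k ((r : ℂ) * x) p).leadingCoeff = L.eval ((r : ℂ) * x) := by
      rw [slicePoly_apply, leadingCoeff_map_of_leadingCoeff_ne_zero _ hr]; rfl
    rwa [h5, h6] at h4
  have h7 := le_of_tendsto_of_tendsto h1 h2 h3
  rw [← norm_pos_iff]
  refine lt_of_lt_of_le (mul_pos (norm_pos_iff.2 hlc) (pow_pos (by linarith) _)) h7

end TwoVariables

/-! ### Coprimality of generic slices -/

section Bezout

/-- Relatively prime polynomials over a factorial domain satisfy a Bezout identity up to a
constant. -/
lemma exists_bezout {R : Type*} [CommRing R] [IsDomain R] [NormalizedGCDMonoid R] {f g : R[X]}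
    (h : IsRelPrime f g) : ∃ u v : R[X], ∃ w : R, w ≠ 0 ∧ u * f + v * g = C w := by
  let K := FractionRing R
  have hinj : Function.Injective (algebraMap R K) := IsFractionRing.injective R K
  have hmi : Function.Injective (Polynomial.map (algebraMap R K)) := map_injective _ hinj
  -- Gauss's lemma: clearing denominators in a common irreducible factor over the fraction field and
  -- taking the primitive part gives a common factor in `R[X]`, which is a unit.
  have hco : IsCoprime (f.map (algebraMap R K)) (g.map (algebraMap R K)) := by
    refine isCoprime_of_irreducible_dvd ?_ fun π hπ hf hg => ?_
    · rintro ⟨h1, h2⟩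
      rw [Polynomial.map_eq_zero_iff hinj] at h1 h2
      subst h1 h2
      exact not_isUnit_zero (h dvd_rfl dvd_rfl)
    obtain ⟨b, hb, hbπ⟩ := IsLocalization.integerNormalization_spec (nonZeroDivisors R) π
    set π' := IsLocalization.integerNormalization (nonZeroDivisors R) π
    have hb0 : algebraMap R K b ≠ 0 := by
      rw [map_ne_zero_iff _ hinj]; exact nonZeroDivisors.ne_zero hb
    have hbπ' : π'.map (algebraMap R K) = C (algebraMap R K b) * π := by
      rw [hbπ, ← algebraMap_smul K b π, smul_eq_C_mul]
    have hπ'0 : π' ≠ 0 := by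
      intro h0
      rw [h0, Polynomial.map_zero] at hbπ'
      exact mul_ne_zero (C_ne_zero.2 hb0) hπ.ne_zero hbπ'.symm
    have hdvd : (π'.primPart.map (algebraMap R K)) ∣ π := by
      have h1 : π'.primPart.map (algebraMap R K) ∣ π'.map (algebraMap R K) :=
        Polynomial.map_dvd _ (primPart_dvd π')
      rw [hbπ'] at h1
      exact (isUnit_C.2 (isUnit_iff_ne_zero.2 hb0)).dvd_mul_left.1 h1
    have hpf := π'.isPrimitive_primPart.dvd_of_fraction_map_dvd_fraction_map (hdvd.trans hf)
    have hpg := π'.isPrimitive_primPart.dvd_of_fraction_map_dvd_fraction_map (hdvd.trans hg)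
    have hu := h hpf hpg
    refine hπ.not_isUnit ?_
    have h2 : IsUnit (π'.map (algebraMap R K)) := by
      rw [π'.eq_C_content_mul_primPart, Polynomial.map_mul, map_C]
      refine IsUnit.mul ?_ (hu.map (mapRingHom (algebraMap R K)))
      refine isUnit_C.2 (isUnit_iff_ne_zero.2 ?_)
      rw [map_ne_zero_iff _ hinj]
      exact mt content_eq_zero_iff.1 hπ'0
    rw [hbπ'] at h2
    exact isUnit_of_mul_isUnit_right h2
  obtain ⟨u, v, huv⟩ := hco
  obtain ⟨b, hb, hbu⟩ := IsLocalization.integerNormalization_spec (nonZeroDivisors R) u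
  obtain ⟨c, hc, hcv⟩ := IsLocalization.integerNormalization_spec (nonZeroDivisors R) v
  refine ⟨C c * IsLocalization.integerNormalization (nonZeroDivisors R) u,
    C b * IsLocalization.integerNormalization (nonZeroDivisors R) v, b * c,
    mul_ne_zero (nonZeroDivisors.ne_zero hb) (nonZeroDivisors.ne_zero hc), hmi ?_⟩
  rw [Polynomial.map_add, Polynomial.map_mul, Polynomial.map_mul, Polynomial.map_mul,
    Polynomial.map_mul, hbu, hcv, ← algebraMap_smul K b u, ← algebraMap_smul K c v, smul_eq_C_mul,
    smul_eq_C_mul, map_C, map_C, map_C, map_mul, C_mul]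
  linear_combination (C (algebraMap R K b) * C (algebraMap R K c)) * huv

/-- The constant `w` of the Bezout identity over `ℂ[X]` plays the part of the resultant: wherever it
does not vanish, the identity specializes to a Bezout identity of the slices. -/
lemma exists_isCoprime_slicePoly (k : Fin 2) {f g : MvPolynomial (Fin 2) ℂ}
    (h : IsRelPrime f g) :
    ∃ w : ℂ[X], w ≠ 0 ∧ ∀ x, w.eval x ≠ 0 → IsCoprime (slicePoly k x f) (slicePoly k x g) := by
  have h' : IsRelPrime (biPoly k f) (biPoly k g) := by
    intro d hf hg
    have h1 : IsUnit ((biPoly k).symm d) := h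
      (by simpa using map_dvd (biPoly k).symm hf) (by simpa using map_dvd (biPoly k).symm hg)
    simpa using h1.map (biPoly k)
  letI : NormalizedGCDMonoid ℂ[X] := Classical.choice inferInstance
  obtain ⟨u, v, w, hw, huv⟩ := exists_bezout h'
  refine ⟨w, hw, fun x hx => ⟨C (w.eval x)⁻¹ * u.map (evalRingHom x),
    C (w.eval x)⁻¹ * v.map (evalRingHom x), ?_⟩⟩
  have h2 := congrArg (Polynomial.map (evalRingHom x)) huv
  rw [Polynomial.map_add, Polynomial.map_mul, Polynomial.map_mul, map_C, coe_evalRingHom] at h2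
  rw [slicePoly_apply, slicePoly_apply, mul_assoc, mul_assoc, ← mul_add, h2, ← C_mul,
    inv_mul_cancel₀ hx, C_1]

end Bezout

/-! ### Null sets on the circle and cancellation of boundary zeros -/

section Cancellation

/-- By translation invariance all points have the same mass, and infinitely many equal positive
masses do not fit into a finite measure. -/
instance : NullSingletonClass (haarAddCircle (T := 1)) := by
  have : Infinite UnitAddCircle := by
    have : Infinite (Set.Ico (0 : ℝ) (0 + 1)) := (Set.Ico_infinite (by norm_num)).to_subtype
    exact Infinite.of_injective _ (AddCircle.equivIco (1 : ℝ) 0).symm.injective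
  refine ⟨fun x => ?_⟩
  by_contra hx
  have h1 : ∀ y : UnitAddCircle, haarAddCircle {y} = haarAddCircle {x} := by
    intro y
    have := measure_preimage_add haarAddCircle (y - x) {y}
    rw [← this]
    congr 1
    ext z
    rw [Set.mem_preimage, Set.mem_singleton_iff, Set.mem_singleton_iff]
    constructor
    · intro h
      have h' : z = y - (y - x) := by rw [eq_sub_iff_add_eq, add_comm]; exact h
      rw [h', sub_sub_cancel]
    · rintro rfl; rw [sub_add_cancel]
  have h3 : ∑' y : UnitAddCircle, haarAddCircle {y} ≤ haarAddCircle (Set.univ : Set UnitAddCircle) :=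
    tsum_meas_le_meas_iUnion_of_disjoint _ (fun y => measurableSet_singleton y)
      (fun a b hab => by simpa using hab) |>.trans (measure_mono (Set.subset_univ _))
  simp_rw [h1] at h3
  rw [ENNReal.tsum_const_eq_top_of_ne_zero hx] at h3
  exact absurd (top_le_iff.1 h3) (measure_ne_top _ _)

lemma injective_circlePoint : Function.Injective circlePoint :=
  Circle.coe_injective.comp (injective_toCircle one_ne_zero)

lemma ae_eval_ne_zero {q : ℂ[X]} (hq : q ≠ 0) :
    ∀ᵐ t : UnitAddCircle ∂haarAddCircle, q.eval (circlePoint t) ≠ 0 := by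
  have h : {t : UnitAddCircle | ¬ q.eval (circlePoint t) ≠ 0}.Finite := by
    refine Set.Finite.subset ((q.roots.toFinset.finite_toSet).preimage
      injective_circlePoint.injOn) fun t ht => ?_
    simp only [Set.mem_setOf_eq, not_not] at ht
    simpa [hq] using ht
  exact h.measure_zero _

lemma exists_circlePoint {z : ℂ} (hz : ‖z‖ = 1) : ∃ t, circlePoint t = z := by
  obtain ⟨t, ht⟩ := (homeomorphCircle (T := 1) one_ne_zero).surjective ⟨z, mem_sphere_zero_iff_norm.2 hz⟩
  rw [homeomorphCircle_apply] at ht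
  exact ⟨t, congrArg Subtype.val ht⟩

lemma forall_of_ae_of_isClosed {P : UnitAddCircle → Prop} (hP : ∀ᵐ t ∂haarAddCircle, P t)
    (hc : IsClosed {t | P t}) (t : UnitAddCircle) : P t := by
  have h := (Measure.dense_of_ae hP).closure_eq
  rw [hc.closure_eq] at h
  have ht : t ∈ {t | P t} := by rw [h]; trivial
  exact ht

variable {N : ℕ}

/-- Cancelling the zeros on the circle. -/
lemma exists_cancel (n : ℕ) (p : ℂ[X]) (Q : Matrix (Fin N) (Fin N) ℂ[X]) (hn : p.natDegree = n)
    (hp0 : p ≠ 0) (hp : ∀ z : ℂ, ‖z‖ < 1 → p.eval z ≠ 0)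
    (hQ : ∀ᵐ t ∂haarAddCircle, ∀ i l,
      ‖(Q i l).eval (circlePoint t)‖ ≤ ‖p.eval (circlePoint t)‖) :
    ∃ (s b : ℂ[X]) (A : Matrix (Fin N) (Fin N) ℂ[X]), s ≠ 0 ∧ p = s * b ∧
      (∀ i l, Q i l = s * A i l) ∧ ∀ z : ℂ, ‖z‖ ≤ 1 → b.eval z ≠ 0 := by
  induction n generalizing p Q with
  | zero =>
    refine ⟨1, p, Q, one_ne_zero, (one_mul p).symm, fun i l => (one_mul _).symm, fun z _ => ?_⟩
    rw [natDegree_eq_zero] at hn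
    obtain ⟨c, rfl⟩ := hn
    simpa using hp0
  | succ n ih =>
    by_cases hroot : ∃ ρ : ℂ, ‖ρ‖ = 1 ∧ p.eval ρ = 0
    swap
    · push Not at hroot
      refine ⟨1, p, Q, one_ne_zero, (one_mul p).symm, fun i l => (one_mul _).symm, fun z hz => ?_⟩
      rcases hz.lt_or_eq with h | h
      · exact hp z h
      · exact hroot z h
    obtain ⟨ρ, hρ, hpρ⟩ := hroot
    -- The bound `‖Q‖ ≤ ‖p‖` extends by continuity from almost every point to the whole circle, so
    -- each entry of `Q` vanishes where `p` does and a common factor `X - C ρ` can be removed.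
    have hQρ : ∀ i l, (Q i l).eval ρ = 0 := by
      intro i l
      obtain ⟨t, rfl⟩ := exists_circlePoint hρ
      have h1 := forall_of_ae_of_isClosed (hQ.mono fun t ht => ht i l)
        (isClosed_le ((Q i l).continuous.comp continuous_circlePoint).norm
          (p.continuous.comp continuous_circlePoint).norm) t
      rw [hpρ, norm_zero] at h1
      exact norm_le_zero_iff.1 h1
    obtain ⟨p1, rfl⟩ := dvd_iff_isRoot.2 hpρ
    have hdiv : ∀ i l, ∃ q, Q i l = (X - C ρ) * q := fun i l => dvd_iff_isRoot.2 (hQρ i l)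
    choose Q1 hQ1 using hdiv
    have hp10 : p1 ≠ 0 := right_ne_zero_of_mul hp0
    obtain ⟨s, b, A, hs, hpb, hA, hb⟩ := ih p1 (Matrix.of Q1) (by
        rw [natDegree_mul (X_sub_C_ne_zero ρ) hp10, natDegree_X_sub_C] at hn
        omega) hp10 (fun z hz h => hp z hz (by rw [eval_mul, h, mul_zero])) (by
        filter_upwards [hQ, ae_eval_ne_zero (X_sub_C_ne_zero ρ)] with t ht ht0 i l
        have h1 := ht i l
        rw [hQ1, eval_mul, eval_mul, norm_mul, norm_mul] at h1
        exact le_of_mul_le_mul_left h1 (norm_pos_iff.2 ht0))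
    refine ⟨(X - C ρ) * s, b, A, mul_ne_zero (X_sub_C_ne_zero ρ) hs, ?_, fun i l => ?_, hb⟩
    · rw [hpb, mul_assoc]
    · rw [hQ1, mul_assoc, ← hA]; rfl

/-- The coefficient identity for a slice whose denominator may vanish on the circle. -/
theorem tsum_fourierCoeff_of_slice {Q : Matrix (Fin N) (Fin N) ℂ[X]} {p a c : ℂ[X]}
    (hp0 : p ≠ 0) (hp : ∀ z : ℂ, ‖z‖ < 1 → p.eval z ≠ 0)
    (hU : ∀ᵐ t ∂haarAddCircle, ratEval Q p (circlePoint t) ∈ Matrix.unitaryGroup (Fin N) ℂ)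
    (hdet : Q.det * c = p ^ N * a) (hco : IsCoprime a c)
    (hc : ∀ z : ℂ, ‖z‖ < 1 → c.eval z ≠ 0) :
    (∀ n < 0, ∀ i l,
      fourierCoeff (fun t : UnitAddCircle => ratEval Q p (circlePoint t) i l) n = 0) ∧
    ∑' n : ℤ, (n.toNat : ℝ≥0∞) * ∑ i, ∑ l,
      ‖fourierCoeff (fun t : UnitAddCircle => ratEval Q p (circlePoint t) i l) n‖ₑ ^ 2 =
      a.natDegree := by
  have hQ : ∀ᵐ t ∂haarAddCircle, ∀ i l,
      ‖(Q i l).eval (circlePoint t)‖ ≤ ‖p.eval (circlePoint t)‖ := by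
    filter_upwards [hU, ae_eval_ne_zero hp0] with t ht ht0 i l
    have h1 := entry_norm_bound_of_unitary ht i l
    rw [ratEval_apply, norm_mul, norm_inv, inv_mul_le_iff₀ (norm_pos_iff.2 ht0), mul_one] at h1
    exact h1
  obtain ⟨s, b, A, hs, rfl, hA, hb⟩ := exists_cancel _ p Q rfl hp0 hp hQ
  have hrat : ∀ z, s.eval z ≠ 0 → ratEval Q (s * b) z = ratEval A b z := by
    intro z hz
    ext i l
    rw [ratEval_apply, ratEval_apply, hA, eval_mul, eval_mul]
    field_simp
  have hrat' : ∀ᵐ t ∂haarAddCircle,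
      ratEval Q (s * b) (circlePoint t) = ratEval A b (circlePoint t) :=
    (ae_eval_ne_zero hs).mono fun t ht => hrat _ ht
  -- After cancellation the function is continuous on the circle, so it is unitary at every point.
  have hUA : ∀ z : ℂ, ‖z‖ = 1 → ratEval A b z ∈ Matrix.unitaryGroup (Fin N) ℂ := by
    intro z hz
    obtain ⟨t, rfl⟩ := exists_circlePoint hz
    refine forall_of_ae_of_isClosed
      (P := fun t => ratEval A b (circlePoint t) ∈ Matrix.unitaryGroup (Fin N) ℂ) ?_ ?_ t
    · filter_upwards [hU, hrat'] with t h1 h2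
      rwa [← h2]
    · simp only [Matrix.mem_unitaryGroup_iff]
      have hcont : Continuous fun t : UnitAddCircle => ratEval A b (circlePoint t) := by
        refine continuous_matrix fun i l => ?_
        exact ((b.continuous.comp continuous_circlePoint).inv₀
          fun t => hb _ (norm_circlePoint t).le).mul ((A i l).continuous.comp continuous_circlePoint)
      exact isClosed_eq (hcont.matrix_mul hcont.star) continuous_const
  have hQA : Q = s • A := by ext1 i l; exact hA i l
  have hdetA : A.det * c = b ^ N * a := by
    rw [hQA, Matrix.det_smul, Fintype.card_fin, mul_pow, mul_assoc, mul_assoc] at hdet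
    exact mul_left_cancel₀ (pow_ne_zero N hs) hdet
  have hfc : ∀ i l n, fourierCoeff
      (fun t : UnitAddCircle => ratEval Q (s * b) (circlePoint t) i l) n =
      fourierCoeff (fun t : UnitAddCircle => ratEval A b (circlePoint t) i l) n := fun i l n =>
    congrFun (fourierCoeff_congr_ae (hrat'.mono fun t ht => congrFun (congrFun ht i) l)) n
  simp_rw [hfc]
  exact tsum_fourierCoeff_ratEval hb hUA hdetA hco hc

end Cancellation
end Bidisk
end

noncomputable section
namespace Bidisk

open scoped ENNReal
open Polynomial AddCircle ToeplitzUnitary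

/-! ### Iterated Fourier coefficients on the torus -/

section Fubini

lemma measurable_pairIndex (j : Fin 2) :
    Measurable fun q : UnitAddCircle × UnitAddCircle => pairIndex j q.1 q.2 := by
  refine measurable_pi_lambda _ fun i => ?_
  by_cases h : i = j
  · simpa [pairIndex, h] using measurable_fst
  · simpa [pairIndex, h] using measurable_snd

lemma measurePreserving_pairIndex (j : Fin 2) :
    MeasurePreserving (fun q : UnitAddCircle × UnitAddCircle => pairIndex j q.1 q.2)
      (haarAddCircle.prod haarAddCircle) torusMeasure := by
  refine ⟨measurable_pairIndex j, ?_⟩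
  refine (Measure.pi_eq fun s hs => ?_).symm
  obtain ⟨k, hjk⟩ : ∃ k : Fin 2, j ≠ k := ⟨j + 1, by omega⟩
  have hpre : (fun q : UnitAddCircle × UnitAddCircle => pairIndex j q.1 q.2) ⁻¹'
      Set.univ.pi s = s j ×ˢ s k := by
    ext q
    simp only [Set.mem_preimage, Set.mem_univ_pi, Set.mem_prod]
    constructor
    · intro h
      have h1 := h j
      have h2 := h k
      rw [pairIndex, if_pos rfl] at h1
      rw [pairIndex, if_neg hjk.symm] at h2
      exact ⟨h1, h2⟩
    · rintro ⟨h1, h2⟩ i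
      rcases (show i = j ∨ i = k by omega) with rfl | rfl
      · rwa [pairIndex, if_pos rfl]
      · rwa [pairIndex, if_neg hjk.symm]
  rw [Measure.map_apply (measurable_pairIndex j) (MeasurableSet.univ_pi hs), hpre,
    Measure.prod_prod]
  rcases (show (j = 0 ∧ k = 1) ∨ (j = 1 ∧ k = 0) by omega) with ⟨rfl, rfl⟩ | ⟨rfl, rfl⟩
  · rw [Fin.prod_univ_two]
  · rw [Fin.prod_univ_two, mul_comm]

lemma torusPoint_pairIndex (j : Fin 2) (x y : UnitAddCircle) :
    torusPoint (pairIndex j x y) = pairIndex j (circlePoint x) (circlePoint y) := by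
  funext i
  by_cases h : i = j <;> simp [torusPoint, pairIndex, circlePoint, h]

lemma mFourier_pairIndex {j k : Fin 2} (hjk : j ≠ k) (n : Fin 2 → ℤ) (x y : UnitAddCircle) :
    UnitAddTorus.mFourier n (pairIndex j x y) = fourier (n j) x * fourier (n k) y := by
  have h : UnitAddTorus.mFourier n (pairIndex j x y) =
      ∏ i, fourier (n i) (pairIndex j x y i) := rfl
  rw [h, Fin.prod_univ_two]
  rcases (show (j = 0 ∧ k = 1) ∨ (j = 1 ∧ k = 0) by omega) with ⟨rfl, rfl⟩ | ⟨rfl, rfl⟩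
  · simp [pairIndex]
  · simp [pairIndex, mul_comm]

lemma ae_ae_of_ae_torus (j : Fin 2) {P : UnitAddTorus (Fin 2) → Prop}
    (h : ∀ᵐ t ∂torusMeasure, P t) :
    ∀ᵐ x ∂haarAddCircle, ∀ᵐ y ∂haarAddCircle, P (pairIndex j x y) :=
  Measure.ae_ae_of_ae_prod ((measurePreserving_pairIndex j).quasiMeasurePreserving.ae h)

variable {f : UnitAddTorus (Fin 2) → ℂ}

lemma aestronglyMeasurable_slice (hf : AEStronglyMeasurable f torusMeasure) (j : Fin 2) (b : ℤ) :
    AEStronglyMeasurable (fun x => fourierCoeff (fun y => f (pairIndex j x y)) b)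
      haarAddCircle := by
  have h1 := hf.comp_measurePreserving (measurePreserving_pairIndex j)
  have h2 : AEStronglyMeasurable (fun q : UnitAddCircle × UnitAddCircle =>
      fourier (-b) q.2 • f (pairIndex j q.1 q.2)) (haarAddCircle.prod haarAddCircle) :=
    (((fourier (-b)).continuous.comp continuous_snd).aestronglyMeasurable).smul h1
  exact h2.integral_prod_right'

lemma norm_fourierCoeff_slice_le (hb : ∀ᵐ t ∂torusMeasure, ‖f t‖ ≤ 1) (j : Fin 2) (b : ℤ) :
    ∀ᵐ x ∂haarAddCircle, ‖fourierCoeff (fun y => f (pairIndex j x y)) b‖ ≤ 1 := by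
  filter_upwards [ae_ae_of_ae_torus j hb] with x hx
  have h1 := norm_integral_le_of_norm_le_const (μ := haarAddCircle) (C := 1)
    (f := fun y => fourier (-b) y • f (pairIndex j x y)) (by
      filter_upwards [hx] with y hy
      rw [norm_smul, fourier_apply, Circle.norm_coe, one_mul]
      exact hy)
  rw [probReal_univ, mul_one] at h1
  exact h1

lemma mFourierCoeff_eq_iterated (hf : AEStronglyMeasurable f torusMeasure)
    (hb : ∀ᵐ t ∂torusMeasure, ‖f t‖ ≤ 1) {j k : Fin 2} (hjk : j ≠ k) (n : Fin 2 → ℤ) :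
    UnitAddTorus.mFourierCoeff f n =
      fourierCoeff (fun x => fourierCoeff (fun y => f (pairIndex j x y)) (n k)) (n j) := by
  have h0 : UnitAddTorus.mFourierCoeff f n =
      ∫ t, UnitAddTorus.mFourier (-n) t • f t ∂torusMeasure := rfl
  have hm : AEStronglyMeasurable (fun t => UnitAddTorus.mFourier (-n) t • f t) torusMeasure :=
    (UnitAddTorus.mFourier (-n)).continuous.aestronglyMeasurable.smul hf
  have hi : Integrable (fun t => UnitAddTorus.mFourier (-n) t • f t) torusMeasure := by
    refine Integrable.of_bound hm 1 (hb.mono fun t ht => ?_)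
    rw [norm_smul]
    refine mul_le_one₀ ?_ (norm_nonneg _) ht
    exact ((UnitAddTorus.mFourier (-n)).norm_coe_le_norm t).trans UnitAddTorus.mFourier_norm.le
  have hmp := measurePreserving_pairIndex j
  rw [h0, ← hmp.map_eq, integral_map hmp.aemeasurable (by rw [hmp.map_eq]; exact hm),
    integral_prod (fun q : UnitAddCircle × UnitAddCircle =>
      UnitAddTorus.mFourier (-n) (pairIndex j q.1 q.2) • f (pairIndex j q.1 q.2))
      ((hmp.integrable_comp hm).2 hi), fourierCoeff]
  refine integral_congr_ae (Eventually.of_forall fun x => ?_)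
  simp only [fourierCoeff]
  rw [← integral_smul]
  refine integral_congr_ae (Eventually.of_forall fun y => ?_)
  simp only [mFourier_pairIndex hjk, smul_eq_mul, Pi.neg_apply, mul_assoc]

lemma tsum_enorm_sq_fourierCoeff {c : UnitAddCircle → ℂ} (hc : MemLp c 2 haarAddCircle) :
    ∑' m : ℤ, ‖fourierCoeff c m‖ₑ ^ 2 = ∫⁻ x, ‖c x‖ₑ ^ 2 ∂haarAddCircle := by
  have h1 := enorm_sq_eq_tsum (_root_.fourierBasis (T := (1 : ℝ))) (hc.toLp c)
  have h2 : ∀ m : ℤ, ‖fourierCoeff c m‖ₑ ^ 2 =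
      ‖inner ℂ (_root_.fourierBasis (T := (1 : ℝ)) m) (hc.toLp c)‖ₑ ^ 2 := by
    intro m
    rw [← HilbertBasis.repr_apply_apply, fourierBasis_repr, fourierCoeff_congr_ae hc.coeFn_toLp]
  simp_rw [h2]
  rw [← h1, Lp.enorm_toLp]
  have h3 := eLpNorm_nnreal_pow_eq_lintegral (f := c) (μ := haarAddCircle)
    (p := (2 : NNReal)) two_ne_zero
  simpa using h3

lemma tsum_enorm_sq_mFourierCoeff (hf : AEStronglyMeasurable f torusMeasure)
    (hb : ∀ᵐ t ∂torusMeasure, ‖f t‖ ≤ 1) {j k : Fin 2} (hjk : j ≠ k) (b : ℤ) :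
    ∑' m : ℤ, ‖UnitAddTorus.mFourierCoeff f (pairIndex j m b)‖ₑ ^ 2 =
      ∫⁻ x, ‖fourierCoeff (fun y => f (pairIndex j x y)) b‖ₑ ^ 2 ∂haarAddCircle := by
  rw [← tsum_enorm_sq_fourierCoeff (MemLp.of_bound (aestronglyMeasurable_slice hf j b) 1
    (norm_fourierCoeff_slice_le hb j b))]
  refine tsum_congr fun m => ?_
  rw [mFourierCoeff_eq_iterated hf hb hjk]
  simp [pairIndex, hjk.symm]

end Fubini

/-! ### Integration of the slice identities -/

section Coefficients

variable {N : ℕ} {Φ : UnitAddTorus (Fin 2) → Matrix (Fin N) (Fin N) ℂ}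

lemma UnitaryAE.norm_entry_le (hΦ : UnitaryAE Φ) (i l : Fin N) :
    ∀ᵐ t ∂torusMeasure, ‖Φ t i l‖ ≤ 1 :=
  hΦ.unitary.mono fun _ ht => entry_norm_bound_of_unitary ht i l

lemma UnitaryAE.mFourierCoeff_eq_zero (hΦ : UnitaryAE Φ) {j k : Fin 2} (hjk : j ≠ k)
    (h : ∀ᵐ x ∂haarAddCircle, ∀ n < 0, ∀ i l,
      fourierCoeff (fun y => Φ (pairIndex j x y) i l) n = 0) {n : Fin 2 → ℤ} (hn : n k < 0)
    (i l : Fin N) : UnitAddTorus.mFourierCoeff (fun t => Φ t i l) n = 0 := by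
  rw [mFourierCoeff_eq_iterated (hΦ.meas i l) (hΦ.norm_entry_le i l) hjk]
  refine integral_eq_zero_of_ae ?_
  filter_upwards [h] with x hx
  rw [hx _ hn, smul_zero]; rfl

/-- For fixed `n k = b`, Parseval in the other variable turns the sum over `n j` into an integral
over the slices. Tonelli moves the sum over `b` inside, and the integrand is then almost everywhere
the constant `d`, against a probability measure. -/
lemma UnitaryAE.tsum_mFourierCoeff (hΦ : UnitaryAE Φ) {j k : Fin 2} (hjk : j ≠ k) (d : ℝ≥0∞)
    (h : ∀ᵐ x ∂haarAddCircle, ∑' n : ℤ, (n.toNat : ℝ≥0∞) * ∑ i, ∑ l,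
      ‖fourierCoeff (fun y => Φ (pairIndex j x y) i l) n‖ₑ ^ 2 = d) :
    ∑' n : Fin 2 → ℤ, (n k).toNat * ∑' (i : Fin N) (l : Fin N),
      ‖UnitAddTorus.mFourierCoeff (fun t => Φ t i l) n‖ₑ ^ 2 = d := by
  have hmeas : ∀ i l (b : ℤ), AEMeasurable
      (fun x => ‖fourierCoeff (fun y => Φ (pairIndex j x y) i l) b‖ₑ ^ 2) haarAddCircle :=
    fun i l b => (aestronglyMeasurable_slice (hΦ.meas i l) j b).enorm.pow_const 2
  let σ : ℤ × ℤ ≃ (Fin 2 → ℤ) :=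
    { toFun := fun q => pairIndex j q.1 q.2
      invFun := fun n => (n j, n k)
      left_inv := fun q => by simp [pairIndex, hjk.symm]
      right_inv := fun n => by
        funext i
        rcases (show i = j ∨ i = k by omega) with rfl | rfl
        · simp [pairIndex]
        · simp [pairIndex, hjk.symm] }
  have hσ : ∀ m b, σ (m, b) = pairIndex j m b := fun _ _ => rfl
  have hσk : ∀ m b, σ (m, b) k = b := fun m b => by simp [hσ, pairIndex, hjk.symm]
  rw [← σ.tsum_eq, ENNReal.tsum_prod (f := fun m b => ((σ (m, b) k).toNat : ℝ≥0∞) *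
    ∑' (i : Fin N) (l : Fin N),
      ‖UnitAddTorus.mFourierCoeff (fun t => Φ t i l) (σ (m, b))‖ₑ ^ 2), ENNReal.tsum_comm]
  simp_rw [hσk, ENNReal.tsum_mul_left, tsum_fintype]
  calc _ = ∑' b : ℤ, ∫⁻ x, (b.toNat : ℝ≥0∞) * ∑ i, ∑ l,
        ‖fourierCoeff (fun y => Φ (pairIndex j x y) i l) b‖ₑ ^ 2 ∂haarAddCircle := by
        refine tsum_congr fun b => ?_
        rw [lintegral_const_mul'' _ (Finset.aemeasurable_fun_sum _ fun i _ =>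
          Finset.aemeasurable_fun_sum _ fun l _ => hmeas i l b),
          lintegral_finsetSum' _ fun i _ => Finset.aemeasurable_fun_sum _ fun l _ => hmeas i l b,
          Summable.tsum_finsetSum fun _ _ => ENNReal.summable]
        congr 1
        refine Finset.sum_congr rfl fun i _ => ?_
        rw [lintegral_finsetSum' _ fun l _ => hmeas i l b,
          Summable.tsum_finsetSum fun _ _ => ENNReal.summable]
        refine Finset.sum_congr rfl fun l _ => ?_
        exact tsum_enorm_sq_mFourierCoeff (hΦ.meas i l) (hΦ.norm_entry_le i l) hjk b
    _ = ∫⁻ x, ∑' b : ℤ, (b.toNat : ℝ≥0∞) * ∑ i, ∑ l,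
        ‖fourierCoeff (fun y => Φ (pairIndex j x y) i l) b‖ₑ ^ 2 ∂haarAddCircle :=
        (lintegral_tsum fun b => (Finset.aemeasurable_fun_sum _ fun i _ =>
          Finset.aemeasurable_fun_sum _ fun l _ => hmeas i l b).const_mul _).symm
    _ = d := by
        rw [lintegral_congr_ae h]
        simp

end Coefficients

/-! ### Rational inner functions on the bidisk -/

section Rational

variable {N : ℕ} {φ : (Fin 2 → ℂ) → Matrix (Fin N) (Fin N) ℂ}
  {Q : Matrix (Fin N) (Fin N) (MvPolynomial (Fin 2) ℂ)} {p : MvPolynomial (Fin 2) ℂ}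

lemma zero_mem_bidisk : (0 : Fin 2 → ℂ) ∈ bidisk := fun j => by simp

lemma ne_zero_of_eval_ne_zero (hp : ∀ z ∈ bidisk, MvPolynomial.eval z p ≠ 0) : p ≠ 0 := by
  rintro rfl
  exact hp 0 zero_mem_bidisk (map_zero _)

lemma continuous_eval_torusPoint (q : MvPolynomial (Fin 2) ℂ) :
    Continuous fun t => MvPolynomial.eval (torusPoint t) q :=
  (MvPolynomial.continuous_eval q).comp (continuous_pi continuous_torusPoint)

lemma ae_eval_torusPoint_ne_zero {q : MvPolynomial (Fin 2) ℂ} (hq : q ≠ 0) :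
    ∀ᵐ t ∂torusMeasure, MvPolynomial.eval (torusPoint t) q ≠ 0 := by
  have hlc : (biPoly 1 q).leadingCoeff ≠ 0 := by simpa using hq
  have hset : MeasurableSet {t | MvPolynomial.eval (torusPoint t) q ≠ 0} :=
    ((isClosed_singleton.preimage (continuous_eval_torusPoint q)).isOpen_compl).measurableSet
  rw [← (measurePreserving_pairIndex 0).map_eq, ae_map_iff (measurable_pairIndex 0).aemeasurable
    hset]
  refine (Measure.ae_prod_iff_ae_ae (measurable_pairIndex 0 hset)).2 ?_
  filter_upwards [ae_eval_ne_zero hlc] with x hx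
  filter_upwards [ae_eval_ne_zero (slicePoly_ne_zero 1 q hx)] with y hy
  rw [torusPoint_pairIndex, ← eval_slicePoly zero_ne_one]
  exact hy

lemma smul_torusPoint_mem_bidisk {r : ℝ} (h0 : 0 < r) (h1 : r < 1) (t : UnitAddTorus (Fin 2)) :
    (r : ℂ) • torusPoint t ∈ bidisk := by
  intro j
  have : ‖torusPoint t j‖ = 1 := Circle.norm_coe _
  rw [Pi.smul_apply, smul_eq_mul, norm_mul, this, mul_one, Complex.norm_real,
    Real.norm_of_nonneg h0.le]
  exact h1

lemma boundaryValue_eq (hQ : ∀ z ∈ bidisk,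
      φ z = (MvPolynomial.eval z p)⁻¹ • Q.map (MvPolynomial.eval z))
    {t : UnitAddTorus (Fin 2)} (ht : MvPolynomial.eval (torusPoint t) p ≠ 0) :
    boundaryValue φ t =
      (MvPolynomial.eval (torusPoint t) p)⁻¹ • Q.map (MvPolynomial.eval (torusPoint t)) := by
  refine Tendsto.limUnder_eq ?_
  have hr : Tendsto (fun r : ℝ => (r : ℂ) • torusPoint t) (𝓝[<] 1) (𝓝 (torusPoint t)) := by
    have : Continuous fun r : ℝ => (r : ℂ) • torusPoint t := by fun_prop
    have h := this.tendsto 1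
    rw [Complex.ofReal_one, one_smul] at h
    exact h.mono_left nhdsWithin_le_nhds
  have hq : ∀ q : MvPolynomial (Fin 2) ℂ, Tendsto
      (fun r : ℝ => MvPolynomial.eval ((r : ℂ) • torusPoint t) q) (𝓝[<] 1)
      (𝓝 (MvPolynomial.eval (torusPoint t) q)) := fun q =>
    ((MvPolynomial.continuous_eval q).tendsto _).comp hr
  have h2 : Tendsto (fun r : ℝ => (MvPolynomial.eval ((r : ℂ) • torusPoint t) p)⁻¹ •
      Q.map (MvPolynomial.eval ((r : ℂ) • torusPoint t))) (𝓝[<] 1)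
      (𝓝 ((MvPolynomial.eval (torusPoint t) p)⁻¹ • Q.map (MvPolynomial.eval (torusPoint t)))) :=
    tendsto_pi_nhds.2 fun i => tendsto_pi_nhds.2 fun l => ((hq p).inv₀ ht).mul (hq (Q i l))
  refine h2.congr' ?_
  filter_upwards [self_mem_nhdsWithin,
    mem_nhdsWithin_of_mem_nhds (Ioi_mem_nhds (show (0 : ℝ) < 1 by norm_num))] with r hr1 hr0
  exact (hQ _ (smul_torusPoint_mem_bidisk hr0 hr1 t)).symm

lemma unitaryAE_boundaryValue (hφ : IsInner φ)
    (hp : ∀ z ∈ bidisk, MvPolynomial.eval z p ≠ 0)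
    (hQ : ∀ z ∈ bidisk, φ z = (MvPolynomial.eval z p)⁻¹ • Q.map (MvPolynomial.eval z)) :
    UnitaryAE (boundaryValue φ) where
  meas i l := by
    have h : AEStronglyMeasurable (fun t => (MvPolynomial.eval (torusPoint t) p)⁻¹ *
        MvPolynomial.eval (torusPoint t) (Q i l)) torusMeasure :=
      ((continuous_eval_torusPoint p).measurable.inv.mul
        (continuous_eval_torusPoint (Q i l)).measurable).aestronglyMeasurable
    refine h.congr ?_
    filter_upwards [ae_eval_torusPoint_ne_zero (ne_zero_of_eval_ne_zero hp)] with t ht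
    rw [boundaryValue_eq hQ ht]
    rfl
  unitary := hφ.unitary_boundaryValue

/-- The identity holds at every point of the bidisk, a product of infinite sets, and such a product
determines polynomials. -/
lemma det_mul_eq (hp : ∀ z ∈ bidisk, MvPolynomial.eval z p ≠ 0)
    (hQ : ∀ z ∈ bidisk, φ z = (MvPolynomial.eval z p)⁻¹ • Q.map (MvPolynomial.eval z))
    {g gt : MvPolynomial (Fin 2) ℂ} (hg : ∀ z ∈ bidisk, MvPolynomial.eval z g ≠ 0)
    (hdet : ∀ z ∈ bidisk, (φ z).det = MvPolynomial.eval z gt / MvPolynomial.eval z g) :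
    Q.det * g = p ^ N * gt := by
  have hinf : Set.Infinite {z : ℂ | ‖z‖ < 1} := by
    refine infinite_of_mem_nhds 0 ?_
    have : {z : ℂ | ‖z‖ < 1} = Metric.ball 0 1 := by ext; simp
    rw [this]
    exact Metric.ball_mem_nhds 0 one_pos
  refine MvPolynomial.funext_set (fun _ => {z : ℂ | ‖z‖ < 1}) (fun _ => hinf) fun z hz => ?_
  have hz' : z ∈ bidisk := fun j => hz j trivial
  have h1 := hdet z hz'
  have h2 : (Q.map (MvPolynomial.eval z)).det = MvPolynomial.eval z Q.det :=
    ((MvPolynomial.eval z).map_det Q).symm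
  rw [hQ z hz', Matrix.det_smul, Fintype.card_fin, h2, eq_div_iff (hg z hz'), inv_pow] at h1
  have h3 := pow_ne_zero N (hp z hz')
  rw [map_mul, map_mul, map_pow, ← h1]
  field_simp

/-- The coefficient identity on almost every slice. -/
theorem ae_slice (hφ : IsInner φ)
    (hp : ∀ z ∈ bidisk, MvPolynomial.eval z p ≠ 0)
    (hQ : ∀ z ∈ bidisk, φ z = (MvPolynomial.eval z p)⁻¹ • Q.map (MvPolynomial.eval z))
    {g gt : MvPolynomial (Fin 2) ℂ} (hg : ∀ z ∈ bidisk, MvPolynomial.eval z g ≠ 0)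
    (hcop : IsRelPrime gt g)
    (hdet : ∀ z ∈ bidisk, (φ z).det = MvPolynomial.eval z gt / MvPolynomial.eval z g)
    {j k : Fin 2} (hjk : j ≠ k) :
    ∀ᵐ x ∂haarAddCircle, (∀ n < 0, ∀ i l,
        fourierCoeff (fun y => boundaryValue φ (pairIndex j x y) i l) n = 0) ∧
      ∑' n : ℤ, (n.toNat : ℝ≥0∞) * ∑ i, ∑ l,
        ‖fourierCoeff (fun y => boundaryValue φ (pairIndex j x y) i l) n‖ₑ ^ 2 =
        (MvPolynomial.degreeOf k gt : ℝ≥0∞) := by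
  have hid := det_mul_eq hp hQ hg hdet
  have hp0 := ne_zero_of_eval_ne_zero hp
  have hg0 := ne_zero_of_eval_ne_zero hg
  have hlc : ∀ {q : MvPolynomial (Fin 2) ℂ}, q ≠ 0 → (biPoly k q).leadingCoeff ≠ 0 :=
    fun hq => by simpa using hq
  obtain ⟨w, hw, hwco⟩ := exists_isCoprime_slicePoly k hcop
  have hdeg : ∀ᵐ x : UnitAddCircle ∂haarAddCircle,
      (slicePoly k (circlePoint x) gt).natDegree = MvPolynomial.degreeOf k gt := by
    by_cases h0 : gt = 0
    · exact Eventually.of_forall fun x => by simp [h0]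
    · exact (ae_eval_ne_zero (hlc h0)).mono fun x hx => natDegree_slicePoly k gt hx
  -- The exceptional `x` are null sets: degree drops, failure of coprimality, vanishing leading
  -- coefficients of the slices of `p` and `g`, and slices on which unitarity or `p ≠ 0` fails on a
  -- set of positive measure.
  filter_upwards [hdeg, ae_eval_ne_zero hw, ae_eval_ne_zero (hlc hp0), ae_eval_ne_zero (hlc hg0),
    ae_ae_of_ae_torus j hφ.unitary_boundaryValue,
    ae_ae_of_ae_torus j (ae_eval_torusPoint_ne_zero hp0)] with x hxd hxw hxp hxg hxU hxb
  have hx1 := norm_circlePoint x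
  let Qx : Matrix (Fin N) (Fin N) ℂ[X] := Q.map (slicePoly k (circlePoint x))
  have hbv : ∀ᵐ y ∂haarAddCircle, boundaryValue φ (pairIndex j x y) =
      ratEval Qx (slicePoly k (circlePoint x) p) (circlePoint y) := by
    filter_upwards [hxb] with y hy
    rw [boundaryValue_eq hQ hy]
    ext i l
    rw [ratEval_apply, torusPoint_pairIndex, eval_slicePoly hjk]
    change _ = _ * ((slicePoly k (circlePoint x)) (Q i l)).eval (circlePoint y)
    rw [eval_slicePoly hjk]
    rfl
  have hdetx : Qx.det * slicePoly k (circlePoint x) g =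
      slicePoly k (circlePoint x) p ^ N * slicePoly k (circlePoint x) gt := by
    have h1 := congrArg (slicePoly k (circlePoint x)) hid
    rw [map_mul, map_mul, map_pow, RingHom.map_det] at h1
    exact h1
  have hmain := tsum_fourierCoeff_of_slice (Q := Qx) (slicePoly_ne_zero k p hxp)
    (fun z hz => eval_slicePoly_ne_zero hjk p hp hx1 hxp hz)
    (by filter_upwards [hxU, hbv] with y h1 h2; rwa [← h2]) hdetx (hwco _ hxw)
    (fun z hz => eval_slicePoly_ne_zero hjk g hg hx1 hxg hz)
  have hfc : ∀ i l n, fourierCoeff (fun y => boundaryValue φ (pairIndex j x y) i l) n =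
      fourierCoeff (fun y =>
        ratEval Qx (slicePoly k (circlePoint x) p) (circlePoint y) i l) n := fun i l n =>
    congrFun (fourierCoeff_congr_ae (hbv.mono fun y hy => congrFun (congrFun hy i) l)) n
  simp_rw [hfc, ← hxd]
  exact hmain

theorem rank_eq_degreeOf (hφ : IsInner φ)
    (hp : ∀ z ∈ bidisk, MvPolynomial.eval z p ≠ 0)
    (hQ : ∀ z ∈ bidisk, φ z = (MvPolynomial.eval z p)⁻¹ • Q.map (MvPolynomial.eval z))
    {g gt : MvPolynomial (Fin 2) ℂ} (hg : ∀ z ∈ bidisk, MvPolynomial.eval z g ≠ 0)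
    (hcop : IsRelPrime gt g)
    (hdet : ∀ z ∈ bidisk, (φ z).det = MvPolynomial.eval z gt / MvPolynomial.eval z g)
    {j k : Fin 2} (hjk : j ≠ k) :
    Module.rank ℂ (ominus (Ksup j φ) (shift j (K φ))) =
        (MvPolynomial.degreeOf k gt : Cardinal) ∧
      Module.rank ℂ (ominus (Ksup j φ) (K φ)) = (MvPolynomial.degreeOf k gt : Cardinal) := by
  have hΦ := unitaryAE_boundaryValue hφ hp hQ
  have h1 := ae_slice hφ hp hQ hg hcop hdet hjk
  -- Analyticity in both variables requires slices in both directions; the dimension uses only those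
  -- in `z_k`.
  have h2 := ae_slice hφ hp hQ hg hcop hdet hjk.symm
  refine rank_of_fourierCoeff φ hΦ ?_ hjk _
    (hΦ.tsum_mFourierCoeff hjk _ (h1.mono fun x hx => hx.2))
  rintro n ⟨x, hx⟩ i l
  rcases (show x = j ∨ x = k by omega) with rfl | rfl
  · exact hΦ.mFourierCoeff_eq_zero hjk.symm (h2.mono fun x hx => hx.1) hx i l
  · exact hΦ.mFourierCoeff_eq_zero hjk (h1.mono fun x hx => hx.1) hx i l

end Rational
end Bidisk
end

theorem mainTheorem1 (N : ℕ)
    (φ : (Fin 2 → ℂ) → Matrix (Fin N) (Fin N) ℂ) (hφ : Bidisk.IsInner φ)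
    (Q : Matrix (Fin N) (Fin N) (MvPolynomial (Fin 2) ℂ)) (p : MvPolynomial (Fin 2) ℂ)
    (hp : ∀ z ∈ Bidisk.bidisk, MvPolynomial.eval z p ≠ 0)
    (hQ : ∀ z ∈ Bidisk.bidisk,
      φ z = (MvPolynomial.eval z p)⁻¹ • Q.map (MvPolynomial.eval z))
    (g gt : MvPolynomial (Fin 2) ℂ)
    (hg : ∀ z ∈ Bidisk.bidisk, MvPolynomial.eval z g ≠ 0)
    (hcop : IsRelPrime gt g)
    (hdet : ∀ z ∈ Bidisk.bidisk,
      (φ z).det = MvPolynomial.eval z gt / MvPolynomial.eval z g) :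
    (Module.rank ℂ (Bidisk.ominus (Bidisk.Ksup 0 φ) (Bidisk.shift 0 (Bidisk.K φ))) =
        (MvPolynomial.degreeOf 1 gt : Cardinal) ∧
      Module.rank ℂ (Bidisk.ominus (Bidisk.Ksup 0 φ) (Bidisk.K φ)) =
        (MvPolynomial.degreeOf 1 gt : Cardinal)) ∧
    (Module.rank ℂ (Bidisk.ominus (Bidisk.Ksup 1 φ) (Bidisk.shift 1 (Bidisk.K φ))) =
        (MvPolynomial.degreeOf 0 gt : Cardinal) ∧
      Module.rank ℂ (Bidisk.ominus (Bidisk.Ksup 1 φ) (Bidisk.K φ)) =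
        (MvPolynomial.degreeOf 0 gt : Cardinal)) := by
  exact ⟨Bidisk.rank_eq_degreeOf hφ hp hQ hg hcop hdet zero_ne_one,
    Bidisk.rank_eq_degreeOf hφ hp hQ hg hcop hdet one_ne_zero⟩
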